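/- Let $-1<\alpha\le\beta<1$ and $0\le\gamma<1$ with $\gamma\ge\mathcal T_0(\alpha,\beta)$, where $$\mathcal T_0(\alpha,\beta)=\begin{cases}1-\dfrac{(1-\alpha\beta)\left[2\sqrt{\alpha\beta(1-\alpha^2)(1-\beta^2)}+(\alpha+\beta)(1-\alpha\beta)\right]}{(1+\alpha\beta)^2}&\text{if }0<\alpha<1\text{ and }\beta_1(\alpha)<\beta<1,\\[2mm] 1-\dfrac{(1+\alpha)(1+\beta)}{2}&\text{otherwise,}\end{cases}$$ $$\beta_1(\alpha)=\frac{(1+\alpha)\sqrt{\alpha^2+14\alpha+1}-(\alpha^2+6\alpha+1)}{2\alpha(1-\alpha)}.$$ Let $\mathbb D=\{z\in\mathbb C:|z|<1\}$ and $$\mathcal T_{\alpha,\beta,\gamma}(z)=1+\frac{(2-2\gamma)z}{(1-\alpha z)(1-\beta z)}.$$ For functions $F,G$ on $\mathbb D$ write $F\prec G$ if $F=G\circ\omega$ on $\mathbb D$ for some analytic $\omega:\mathbb D\to\mathbb D$ with $\omega(0)=0$. Let $\mathcal{CV}_{snail}(\alpha,\beta,\gamma)$ be the class of functions $f$ analytic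 in $\mathbb D$ with $f(0)=0$, $f'(0)=1$, $f'\ne0$ in $\mathbb D$, and $1+zf''(z)/f'(z)\prec\mathcal T_{\alpha,\beta,\gamma}(z)$. Let $$K(z)=K_{\alpha,\beta,\gamma}(z)=\int_0^z\exp\left(\int_0^w\frac{2(1-\gamma)}{(1-\alpha t)(1-\beta t)}\,dt\right)dw ,$$ and call the functions $\overline\mu K(\mu z)$ with $|\mu|=1$ the rotations of $K$. Then $K$ and $K'$ are real-valued on $(-1,1)$, and the following hold. 1. If $f\in\mathcal{CV}_{snail}(\alpha,\beta,\gamma)$ and $|z|=r<1$, then $$-K(-r)\le|f(z)|\le K(r),\qquad K'(-r)\le|f'(z)|\le K'(r),\qquad |\operatorname{Arg}f'(z)|\le\max_{|w|=r}\operatorname{Arg}K'(w),$$ where $\operatorname{Arg}$ is the principal argument and the maximum is attained. 2. These bounds are sharp: all rotations of $K$ belong to $\mathcal{CV}_{snail}(\alpha,\beta,\gamma)$, and for every given point $z$ with $0<|z|<1$ equality holds at $z$ in each of the five inequalities for some rotation of $K$ (depending on the inequality and on $z$). 3. If $f\in\mathcal{CV}_{snail}(\alpha,\beta,\gamma)$,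 then $f'\prec K'$. 4. The limit $-K(-1):=\lim_{r\to1^-}[-K(-r)]$ exists and is finite, and if $f\in\mathcal{CV}_{snail}(\alpha,\beta,\gamma)$, then either $f$ is a rotation of $K$ or $\{w\in\mathbb C:|w|\le -K(-1)\}\subset f(\mathbb D)$. -/

import Mathlib

open Set Filter Topology

noncomputable section

namespace Snail

/-- The open unit disk `𝔻`. -/
def unitDisk : Set ℂ := Metric.ball (0 : ℂ) 1

/-- Subordination `F ≺ G` in the unit disk: `F = G ∘ ω` on `𝔻` for an analytic self-map `ω`
of `𝔻` with `ω 0 = 0`. -/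
def Subordinate (F G : ℂ → ℂ) : Prop :=
  ∃ ω : ℂ → ℂ, DifferentiableOn ℂ ω unitDisk ∧ MapsTo ω unitDisk unitDisk ∧ ω 0 = 0 ∧
    ∀ z ∈ unitDisk, F z = G (ω z)

/-- `𝔏_{α,β,γ}(z) = (2 - 2γ) z / ((1 - α z)(1 - β z))`. -/
def snailL (α β γ : ℝ) (z : ℂ) : ℂ :=
  (2 - 2 * (γ : ℂ)) * z / ((1 - (α : ℂ) * z) * (1 - (β : ℂ) * z))

/-- `𝒯_{α,β,γ} = 1 + 𝔏_{α,β,γ}`. -/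
def snailT (α β γ : ℝ) (z : ℂ) : ℂ := 1 + snailL α β γ z

/-- The threshold `β₁(α)`, used for `0 < α < 1`. -/
def betaOne (α : ℝ) : ℝ :=
  ((1 + α) * Real.sqrt (α ^ 2 + 14 * α + 1) - (α ^ 2 + 6 * α + 1)) / (2 * α * (1 - α))

/-- The parameter region `B₁ = {0 < α < 1, β₁(α) < β < 1}`. -/
def regionB1 : Set (ℝ × ℝ) := {p | 0 < p.1 ∧ p.1 < 1 ∧ betaOne p.1 < p.2 ∧ p.2 < 1}

open Classical in
/-- The lower bound `𝒯₀(α,β)` imposed on the parameter `γ`. -/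
def snailT0 (α β : ℝ) : ℝ :=
  if (α, β) ∈ regionB1 then
    1 - (1 - α * β) *
        (2 * Real.sqrt (α * β * (1 - α ^ 2) * (1 - β ^ 2)) + (α + β) * (1 - α * β)) /
      (1 + α * β) ^ 2
  else 1 - (1 + α) * (1 + β) / 2

/-- The class `CV_snail(α,β,γ)`: functions `f` analytic and locally univalent in `𝔻`, normalized
by `f 0 = 0` and `f' 0 = 1`, with `1 + z f''(z) / f'(z) ≺ 𝒯_{α,β,γ}(z)`. -/
def CVsnail (α β γ : ℝ) : Set (ℂ → ℂ) :=
  {f | DifferentiableOn ℂ f unitDisk ∧ f 0 = 0 ∧ deriv f 0 = 1 ∧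
    (∀ z ∈ unitDisk, deriv f z ≠ 0) ∧
    Subordinate (fun z => 1 + z * deriv (deriv f) z / deriv f z) (snailT α β γ)}

/-- The complex line integral `∫_0^z g(t) dt` along the straight segment from `0` to `z`. -/
def segIntegral (g : ℂ → ℂ) (z : ℂ) : ℂ := ∫ s in (0 : ℝ)..1, z * g ((s : ℂ) * z)

/-- The extremal function
`K_{α,β,γ}(z) = ∫_0^z exp (∫_0^w 2(1-γ) / ((1 - α t)(1 - β t)) dt) dw`. -/
def snailK (α β γ : ℝ) (z : ℂ) : ℂ :=
  segIntegral
    (fun w => Complex.exp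
      (segIntegral
        (fun t => 2 * (1 - (γ : ℂ)) / ((1 - (α : ℂ) * t) * (1 - (β : ℂ) * t))) w)) z

/-- The rotation `z ↦ conj μ * K_{α,β,γ}(μ z)`; used for `‖μ‖ = 1`. -/
def rotK (α β γ : ℝ) (μ : ℂ) (z : ℂ) : ℂ :=
  (starRingEnd ℂ) μ * snailK α β γ (μ * z)

/-- The set of the values `Arg K'_{α,β,γ}(w)` (principal argument) on the circle `|w| = r`. -/
def argValues (α β γ r : ℝ) : Set ℝ :=
  (fun w : ℂ => Complex.arg (deriv (snailK α β γ) w)) '' {w : ℂ | ‖w‖ = r}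

end Snail

end

noncomputable section

namespace Snail

/-! Write `Q = log K'`, so that `z Q' = 𝔏`. For `f` in the class and `g = log f'`, the hypothesis
reads `z g' = 𝔏 ∘ φ` with `φ` a self-map of the disk. Since `1/𝔏` is a Joukowski-type map, it
carries circles about the origin to ellipses, which makes `𝔏` starlike. Suffridge's argument based
on Jack's lemma (`subordinate_snailQ`) then gives `log f' = Q ∘ ω` with `ω` a Schwarz function.
Hence `f' ≺ K'`, and the bounds for `|f'|` and `Arg f'` reduce to the behaviour of `Q` on circles:
`Re Q` is extremal at the two real points, because `Im 𝔏` has the sign of `Im z`. Radial integration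
gives the upper growth bound.

The lower growth bound and the covering statement need geometry. The condition `γ ≥ 𝒯₀` is used to
make `Re 𝒯 > 0` (`snailT0_quadratic`, `snailT_re_pos`), so `f` is convex, and therefore starlike:
`Re h > 0` for `h = f/(z f')`. Moving `z` in the direction `-z h` shrinks `f` radially and also
shrinks `|z|`. If `k' < |f'|`, the quantity `|f(z)| - k(|z|)` decreases along this motion, so on an
annulus it is minimal on the inner circle. Shrinking the inner circle to `0` yields `k(|z|) ≤
|f(z)|`, with no need for univalence of `f`.

For covering, equality in the Schwarz lemma for `ω` forces `f` to be a rotation of `K`. Otherwise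
the lower distortion bound is strict, so `|f| - k` has a positive gap on one circle, and the gap
persists up to the boundary. The image then covers a disk of radius larger than `-K(-1)`. -/

theorem mem_unitDisk {z : ℂ} : z ∈ unitDisk ↔ ‖z‖ < 1 := by
  simp [unitDisk]

theorem isOpen_unitDisk : IsOpen unitDisk := Metric.isOpen_ball

theorem unitDisk_mem_nhds {z : ℂ} (hz : ‖z‖ < 1) : unitDisk ∈ 𝓝 z :=
  isOpen_unitDisk.mem_nhds (mem_unitDisk.2 hz)

theorem zero_mem_unitDisk : (0 : ℂ) ∈ unitDisk := mem_unitDisk.2 (by simp)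

/-! ### Integrals along radial segments -/

/-- A function with primitive `G` integrates to `G z - G 0` along the segment from `0` to `z`. -/
theorem segIntegral_eq_sub {G g : ℂ → ℂ} {R : ℝ} {z : ℂ}
    (hG : ∀ w ∈ Metric.ball (0 : ℂ) R, HasDerivAt G (g w) w)
    (hg : ContinuousOn g (Metric.ball 0 R)) (hz : z ∈ Metric.ball (0 : ℂ) R) :
    segIntegral g z = G z - G 0 := by
  have hmem : ∀ s ∈ uIcc (0 : ℝ) 1, (s : ℂ) * z ∈ Metric.ball (0 : ℂ) R := by
    intro s hs
    rw [uIcc_of_le zero_le_one] at hs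
    rw [mem_ball_zero_iff] at hz ⊢
    rw [norm_mul, Complex.norm_real, Real.norm_of_nonneg hs.1]
    exact (mul_le_of_le_one_left (norm_nonneg z) hs.2).trans_lt hz
  have hder : ∀ s ∈ uIcc (0 : ℝ) 1,
      HasDerivAt (fun s : ℝ => G ((s : ℂ) * z)) (z * g ((s : ℂ) * z)) s := by
    intro s hs
    have h1 : HasDerivAt (fun τ : ℂ => τ * z) z (s : ℂ) := by
      simpa using (hasDerivAt_id (s : ℂ)).mul_const z
    have h2 := (hG _ (hmem s hs)).comp (s : ℂ) h1
    rw [mul_comm] at h2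
    exact h2.comp_ofReal
  have hint : IntervalIntegrable (fun s : ℝ => z * g ((s : ℂ) * z)) MeasureTheory.volume 0 1 := by
    apply ContinuousOn.intervalIntegrable
    exact continuousOn_const.mul (hg.comp (by fun_prop) hmem)
  have := intervalIntegral.integral_eq_sub_of_hasDerivAt hder hint
  simpa [segIntegral] using this

theorem hasDerivAt_segIntegral {g : ℂ → ℂ} {R : ℝ} {z : ℂ}
    (hg : DifferentiableOn ℂ g (Metric.ball 0 R)) (hz : z ∈ Metric.ball (0 : ℂ) R) :
    HasDerivAt (segIntegral g) (g z) z := by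
  obtain ⟨G, hG⟩ := hg.isExactOn_ball
  have h := (hG z hz).sub_const (G 0)
  refine h.congr_of_eventuallyEq ?_
  filter_upwards [Metric.isOpen_ball.mem_nhds hz] with w hw
  exact segIntegral_eq_sub hG hg.continuousOn hw

theorem segIntegral_zero (g : ℂ → ℂ) : segIntegral g 0 = 0 := by
  simp [segIntegral]

theorem segIntegral_conj {g : ℂ → ℂ}
    (hg : ∀ z, g ((starRingEnd ℂ) z) = (starRingEnd ℂ) (g z)) (z : ℂ) :
    segIntegral g ((starRingEnd ℂ) z) = (starRingEnd ℂ) (segIntegral g z) := by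
  unfold segIntegral
  rw [← intervalIntegral.intervalIntegral_conj]
  congr 1
  ext s
  rw [map_mul, ← hg, map_mul, Complex.conj_ofReal]

/-! ### One-sided first order conditions -/

theorem eventually_lt_of_hasDerivAt_neg {φ : ℝ → ℝ} {D a : ℝ} (h : HasDerivAt φ D a)
    (hD : D < 0) : ∀ᶠ t in 𝓝[>] a, φ t < φ a := by
  have h1 := (hasDerivWithinAt_iff_tendsto_slope' (by simp)).1 (h.hasDerivWithinAt (s := Ioi a))
  filter_upwards [h1.eventually_lt_const hD, self_mem_nhdsWithin] with t ht hta
  rw [slope_def_field, div_lt_iff₀ (sub_pos.2 hta)] at ht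
  linarith

theorem nonneg_of_hasDerivAt_of_eventually_ge {φ : ℝ → ℝ} {D a : ℝ} (h : HasDerivAt φ D a)
    (hφ : ∀ᶠ t in 𝓝[>] a, φ a ≤ φ t) : 0 ≤ D := by
  by_contra! hD
  obtain ⟨t, h1, h2⟩ := ((eventually_lt_of_hasDerivAt_neg h hD).and hφ).exists
  exact absurd h1 (not_lt.2 h2)

theorem hasDerivAt_along_line {F : ℂ → ℂ} {F' z d : ℂ} (h : HasDerivAt F F' z) :
    HasDerivAt (fun t : ℝ => F (z * (1 + t * d))) (F' * (z * d)) 0 := by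
  have h1 : HasDerivAt (fun τ : ℂ => z * (1 + τ * d)) (z * d) ((0 : ℝ) : ℂ) := by
    simpa using (((hasDerivAt_id ((0 : ℝ) : ℂ)).mul_const d).const_add 1).const_mul z
  have h2 : HasDerivAt F F' (z * (1 + ((0 : ℝ) : ℂ) * d)) := by simpa using h
  exact (HasDerivAt.comp ((0 : ℝ) : ℂ) h2 h1).comp_ofReal

theorem hasDerivAt_norm_sq {u : ℝ → ℂ} {u' : ℂ} {t : ℝ} (h : HasDerivAt u u' t) :
    HasDerivAt (fun t => ‖u t‖ ^ 2) (2 * ((starRingEnd ℂ) (u t) * u').re) t := by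
  have := h.norm_sq
  rwa [Complex.inner, mul_comm u'] at this

theorem hasDerivAt_norm {u : ℝ → ℂ} {u' : ℂ} {t : ℝ} (h : HasDerivAt u u' t) (h0 : u t ≠ 0) :
    HasDerivAt (fun t => ‖u t‖) (((starRingEnd ℂ) (u t) * u').re / ‖u t‖) t := by
  have h1 := (hasDerivAt_norm_sq h).sqrt (by simpa using h0)
  simp only [Real.sqrt_sq (norm_nonneg _)] at h1
  convert h1 using 1
  rw [mul_div_mul_left _ _ two_ne_zero]

theorem eventually_norm_mul_lt {z d : ℂ} (hz : z ≠ 0) (hd : d.re < 0) :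
    ∀ᶠ t : ℝ in 𝓝[>] 0, ‖z * (1 + t * d)‖ < ‖z‖ := by
  have h := hasDerivAt_norm (hasDerivAt_along_line (d := d) (hasDerivAt_id z)) (by simpa using hz)
  have hD := eventually_lt_of_hasDerivAt_neg h ?_
  · simpa using hD
  · simp only [id, Complex.ofReal_zero, zero_mul, add_zero, mul_one, one_mul]
    rw [← mul_assoc, ← Complex.normSq_eq_conj_mul_self, Complex.re_ofReal_mul]
    exact div_neg_of_neg_of_pos (mul_neg_of_pos_of_neg (Complex.normSq_pos.2 hz) hd)
      (norm_pos_iff.2 hz)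

/-- The dual cone of the left half-plane is the negative real axis. -/
theorem im_eq_zero_of_forall_re_mul_nonneg {c : ℂ} (h : ∀ d : ℂ, d.re < 0 → 0 ≤ (c * d).re) :
    c.im = 0 ∧ c.re ≤ 0 := by
  have key : ∀ a b : ℝ, a < 0 → 0 ≤ c.re * a - c.im * b := by
    intro a b ha
    have := h ⟨a, b⟩ ha
    simpa [Complex.mul_re] using this
  refine ⟨?_, by linarith [key (-1) 0 (by norm_num)]⟩
  by_contra hne
  -- This `b` makes the real part of `c * d` equal to `-1`.
  have := key (-1) ((1 - c.re) / c.im) (by norm_num)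
  rw [mul_div_cancel₀ _ hne] at this
  linarith

/-! ### First-contact arguments: Jack's lemma and positivity of the real part -/

/-- **Jack's lemma**: at a boundary point where a function vanishing at the origin attains the
maximum of its modulus, its logarithmic derivative is real and at least `1`. -/
theorem jack_lemma {ω : ℂ → ℂ} {ω' z : ℂ} (hz : z ≠ 0)
    (hd : DifferentiableOn ℂ ω (Metric.ball 0 ‖z‖))
    (hmaps : ∀ w, ‖w‖ < ‖z‖ → ‖ω w‖ ≤ 1) (h0 : ω 0 = 0)
    (hz1 : ‖ω z‖ = 1) (hder : HasDerivAt ω ω' z) :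
    ∃ m : ℝ, 1 ≤ m ∧ z * ω' = m * ω z := by
  have hz' : 0 < ‖z‖ := norm_pos_iff.2 hz
  have hschw : ∀ w, ‖w‖ < ‖z‖ → ‖ω w‖ ≤ ‖w‖ / ‖z‖ := by
    intro w hw
    have := Complex.dist_le_div_mul_dist_of_mapsTo_ball (R₂ := 1) hd
      (fun w hw => by simpa [h0] using hmaps w (by simpa using hw)) (by simpa using hw)
    simpa [h0, div_eq_inv_mul] using this
  set D : ℂ := (starRingEnd ℂ) (ω z) * (z * ω') with hD
  -- By the Schwarz bound `|ω(z(1+td))| ≤ |1+td|` for small `t > 0` whenever `Re d < 0`, with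
  -- equality at `t = 0`; comparing derivatives of the squares gives the sign for every such `d`.
  have hcone : ∀ d : ℂ, d.re < 0 → 0 ≤ ((1 - D) * d).re := by
    intro d hd
    have h1 := hasDerivAt_norm_sq (hasDerivAt_along_line (d := d) hder)
    have h2 := hasDerivAt_norm_sq (hasDerivAt_along_line (d := d) (hasDerivAt_id (1 : ℂ)))
    have h3 := nonneg_of_hasDerivAt_of_eventually_ge (h2.sub h1) ?_
    · simp only [id, Complex.ofReal_zero, zero_mul, add_zero, mul_one, one_mul, map_one] at h3
      have : (1 - D) * d = d - (starRingEnd ℂ) (ω z) * (ω' * (z * d)) := by rw [hD]; ring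
      rw [this, Complex.sub_re]
      linarith
    · filter_upwards [eventually_norm_mul_lt hz hd] with t ht
      have h4 := hschw _ ht
      rw [norm_mul, mul_div_cancel_left₀ _ hz'.ne'] at h4
      have h5 : ‖ω (z * (1 + t * d))‖ ^ 2 ≤ ‖(1 + t * d : ℂ)‖ ^ 2 := by gcongr
      simp [hz1]
      simpa using h5
  obtain ⟨him, hre⟩ := im_eq_zero_of_forall_re_mul_nonneg hcone
  simp only [Complex.sub_im, Complex.one_im, Complex.sub_re, Complex.one_re] at him hre
  refine ⟨D.re, by linarith, ?_⟩
  have hDre : ((D.re : ℝ) : ℂ) = D := Complex.ext (by simp) (by simp; linarith)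
  have hone : ω z * (starRingEnd ℂ) (ω z) = 1 := by
    rw [Complex.mul_conj, Complex.normSq_eq_norm_sq, hz1]; simp
  rw [hDre, hD]
  linear_combination (-(z * ω')) * hone

/-- If `h P + z h' = 1` with `Re P > 0` and `h 0 = 1`, then `Re h > 0`. -/
theorem re_pos_of_mul_add_deriv_eq_one {h h' P : ℂ → ℂ}
    (hd : ∀ z ∈ unitDisk, HasDerivAt h (h' z) z) (h0 : h 0 = 1)
    (hP : ∀ z ∈ unitDisk, 0 < (P z).re) (heq : ∀ z ∈ unitDisk, h z * P z + z * h' z = 1) :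
    ∀ z ∈ unitDisk, 0 < (h z).re := by
  by_contra! hcon
  obtain ⟨z₁, hz₁, hneg⟩ := hcon
  rw [mem_unitDisk] at hz₁
  have hcont : ContinuousOn (fun z => (h z).re) (Metric.closedBall 0 ‖z₁‖) := by
    intro z hz
    have hz' : z ∈ unitDisk := mem_unitDisk.2 ((mem_closedBall_zero_iff.1 hz).trans_lt hz₁)
    exact (Complex.continuous_re.continuousAt.comp (hd z hz').continuousAt).continuousWithinAt
  have hcl : IsCompact (Metric.closedBall (0 : ℂ) ‖z₁‖ ∩ (fun z => (h z).re) ⁻¹' Iic 0) :=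
    (isCompact_closedBall 0 ‖z₁‖).of_isClosed_subset
      (hcont.preimage_isClosed_of_isClosed Metric.isClosed_closedBall isClosed_Iic)
      inter_subset_left
  obtain ⟨z, ⟨hzb, hzn⟩, hmin⟩ := hcl.exists_isMinOn ⟨z₁, by simp, hneg⟩
    (continuous_norm.continuousOn)
  rw [mem_closedBall_zero_iff] at hzb
  have hzn : (h z).re ≤ 0 := hzn
  have hzd : z ∈ unitDisk := mem_unitDisk.2 (hzb.trans_lt hz₁)
  have hpos : ∀ w, ‖w‖ < ‖z‖ → 0 < (h w).re := by
    intro w hw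
    by_contra! hw'
    exact absurd (hmin (show w ∈ _ from ⟨by simpa using hw.le.trans hzb, hw'⟩)) (not_le.2 hw)
  have hz0 : z ≠ 0 := by
    rintro rfl
    rw [h0] at hzn
    norm_num at hzn
  have hline : ∀ d : ℂ, HasDerivAt (fun t : ℝ => (h (z * (1 + t * d))).re)
      (h' z * (z * d)).re 0 := fun d => by
    have := (hasDerivAt_along_line (d := d) (hd z hzd))
    exact (Complex.reCLM.hasFDerivAt.comp_hasDerivAt (0 : ℝ) this)
  have hre : (h z).re = 0 := by
    refine le_antisymm hzn ?_
    have h1 : Tendsto (fun t : ℝ => (h (z * (1 + t * (-1)))).re) (𝓝[>] 0) (𝓝 (h z).re) := by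
      have := (hline (-1)).continuousAt.tendsto.mono_left (nhdsWithin_le_nhds (s := Ioi 0))
      simpa using this
    refine ge_of_tendsto h1 ?_
    filter_upwards [eventually_norm_mul_lt (d := -1) hz0 (by simp)] with t ht
    exact (hpos _ ht).le
  have hcone : ∀ d : ℂ, d.re < 0 → 0 ≤ ((z * h' z) * d).re := by
    intro d hd
    have h3 := nonneg_of_hasDerivAt_of_eventually_ge (hline d) ?_
    · rwa [show z * h' z * d = h' z * (z * d) by ring]
    · filter_upwards [eventually_norm_mul_lt hz0 hd] with t ht
      simpa [hre] using (hpos _ ht).le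
  obtain ⟨him, hre'⟩ := im_eq_zero_of_forall_re_mul_nonneg hcone
  -- At the first contact point `Re h = 0` and `z h'` is real and nonpositive. The imaginary part of
  -- the equation then forces `h z = 0`, leaving `z h' = 1`, which is absurd.
  have he := heq z hzd
  have e1 := congrArg Complex.im he
  have e2 := congrArg Complex.re he
  simp only [Complex.add_im, Complex.add_re, Complex.one_im, Complex.one_re, him, add_zero] at e1 e2
  rw [Complex.mul_im, hre] at e1
  rw [Complex.mul_re, hre] at e2
  have hy : (h z).im = 0 := by
    rcases mul_eq_zero.1 (by linarith : (h z).im * (P z).re = 0) with h | h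
    · exact h
    · exact absurd h (hP z hzd).ne'
  rw [hy] at e2
  linarith

/-! ### Descent for `|f(z)| - k(|z|)`, covering, and the maximum principle -/

/-- Moving against the gradient of `|f|` towards the origin decreases `|f(z)| - k(|z|)` as soon as
`k' < |f'|` and `Re (z f' / f) > 0`. -/
theorem frequently_norm_sub_lt {f : ℂ → ℂ} {f' z : ℂ} {k : ℝ → ℝ} {k' : ℝ} (hz : z ≠ 0)
    (hf : HasDerivAt f f' z) (hk : HasDerivAt k k' ‖z‖) (hk0 : 0 ≤ k') (hkf : k' < ‖f'‖)
    (hh : 0 < (f z / (z * f')).re) :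
    ∃ᶠ w in 𝓝 z, ‖w‖ < ‖z‖ ∧ ‖f w‖ - k ‖w‖ < ‖f z‖ - k ‖z‖ := by
  set h : ℂ := f z / (z * f') with hdef
  have hf' : f' ≠ 0 := norm_pos_iff.1 (hk0.trans_lt hkf)
  have hfz : f z ≠ 0 := by
    intro h0
    rw [hdef, h0] at hh
    simp at hh
  have hfh : f z = z * f' * h := by
    rw [hdef]; field_simp
  -- The direction is chosen because `f' * z * h = f z`: to first order `f` is multiplied by `1 -
  -- t`.
  have h1 : HasDerivAt (fun t : ℝ => ‖f (z * (1 + t * (-h)))‖) (-‖f z‖) 0 := by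
    have := hasDerivAt_norm (hasDerivAt_along_line (d := -h) hf) (by simpa using hfz)
    simp only [Complex.ofReal_zero, zero_mul, add_zero, mul_one] at this
    convert this using 1
    rw [show f' * (z * -h) = - f z by rw [hfh]; ring, mul_neg,
      ← Complex.normSq_eq_conj_mul_self, Complex.neg_re, Complex.ofReal_re,
      Complex.normSq_eq_norm_sq]
    field_simp [norm_ne_zero_iff.2 hfz]
  have h2 : HasDerivAt (fun t : ℝ => ‖z * (1 + t * (-h))‖) (-(‖z‖ * h.re)) 0 := by
    have := hasDerivAt_norm (hasDerivAt_along_line (d := -h) (hasDerivAt_id z)) (by simpa using hz)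
    simp only [id, Complex.ofReal_zero, zero_mul, add_zero, mul_one, one_mul] at this
    convert this using 1
    rw [← mul_assoc, ← Complex.normSq_eq_conj_mul_self, Complex.re_ofReal_mul,
      Complex.normSq_eq_norm_sq, Complex.neg_re]
    field_simp [norm_ne_zero_iff.2 hz]
  have h3 : HasDerivAt (fun t : ℝ => k ‖z * (1 + t * (-h))‖) (k' * (-(‖z‖ * h.re))) 0 := by
    have hk' : HasDerivAt k k' ‖z * (1 + ((0 : ℝ) : ℂ) * (-h))‖ := by simpa using hk
    exact hk'.comp (0 : ℝ) h2
  have hneg : -‖f z‖ - k' * (-(‖z‖ * h.re)) < 0 := by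
    have e1 : ‖f z‖ = ‖z‖ * ‖f'‖ * ‖h‖ := by rw [hfh]; simp
    have e2 : h.re ≤ ‖h‖ := Complex.re_le_norm h
    have e3 : 0 < ‖z‖ := norm_pos_iff.2 hz
    have e4 : ‖z‖ * (k' * h.re) < ‖z‖ * (‖f'‖ * ‖h‖) := by
      apply mul_lt_mul_of_pos_left _ e3
      calc k' * h.re < ‖f'‖ * h.re := by gcongr
        _ ≤ ‖f'‖ * ‖h‖ := by gcongr
    rw [e1]; linarith
  have h4 := eventually_lt_of_hasDerivAt_neg (h1.sub h3) hneg
  have h5 := eventually_norm_mul_lt (d := -h) hz (by simpa using hh)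
  have h6 : Tendsto (fun t : ℝ => z * (1 + t * (-h))) (𝓝[>] 0) (𝓝 z) := by
    have : Continuous (fun t : ℝ => z * (1 + t * (-h))) := by fun_prop
    have := (this.tendsto 0).mono_left (nhdsWithin_le_nhds (s := Ioi 0))
    simpa using this
  refine h6.frequently (Eventually.frequently ?_)
  filter_upwards [h4, h5] with t ht1 ht2
  exact ⟨ht2, by simpa using ht1⟩

/-- In an annulus, `|f(z)| - k(|z|)` is minimized on the inner circle if `k' < |f'|` and
`Re (z f' / f) > 0`. -/
theorem exists_norm_sub_le_inner_circle {f : ℂ → ℂ} {k k' : ℝ → ℝ}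
    (hf : DifferentiableOn ℂ f unitDisk)
    (hk : ∀ ρ, 0 < ρ → ρ < 1 → HasDerivAt k (k' ρ) ρ) (hk0 : ∀ ρ, 0 < ρ → ρ < 1 → 0 ≤ k' ρ)
    (hkf : ∀ z, z ≠ 0 → ‖z‖ < 1 → k' ‖z‖ < ‖deriv f z‖)
    (hh : ∀ z, z ≠ 0 → ‖z‖ < 1 → 0 < (f z / (z * deriv f z)).re)
    {a : ℝ} (ha : 0 < a) {z : ℂ} (haz : a ≤ ‖z‖) (hz : ‖z‖ < 1) :
    ∃ w, ‖w‖ = a ∧ ‖f w‖ - k ‖w‖ ≤ ‖f z‖ - k ‖z‖ := by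
  have hdf : ∀ w, ‖w‖ < 1 → HasDerivAt f (deriv f w) w := fun w hw =>
    (hf.differentiableAt (unitDisk_mem_nhds hw)).hasDerivAt
  have hcomp : IsCompact (Metric.closedBall (0 : ℂ) ‖z‖ ∩ {w | a ≤ ‖w‖}) :=
    (isCompact_closedBall 0 ‖z‖).inter_right (isClosed_le continuous_const continuous_norm)
  have hcont : ContinuousOn (fun w => ‖f w‖ - k ‖w‖)
      (Metric.closedBall (0 : ℂ) ‖z‖ ∩ {w | a ≤ ‖w‖}) := by
    rintro w ⟨hw, hwa⟩
    have hwa : a ≤ ‖w‖ := hwa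
    rw [mem_closedBall_zero_iff] at hw
    have h1 := (hdf w (hw.trans_lt hz)).continuousAt.norm
    have h2 : ContinuousAt (fun w : ℂ => k ‖w‖) w :=
      ContinuousAt.comp (g := k) (hk ‖w‖ (ha.trans_le hwa) (hw.trans_lt hz)).continuousAt
        continuous_norm.continuousAt
    exact (h1.sub h2).continuousWithinAt
  obtain ⟨w, ⟨hw, hwa⟩, hmin⟩ := hcomp.exists_isMinOn ⟨z, by simp, haz⟩ hcont
  have hwa : a ≤ ‖w‖ := hwa
  rw [mem_closedBall_zero_iff] at hw
  refine ⟨w, ?_, hmin (show z ∈ _ from ⟨by simp, haz⟩)⟩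
  by_contra hne
  have hlt : a < ‖w‖ := lt_of_le_of_ne hwa (Ne.symm hne)
  have hw0 : w ≠ 0 := norm_pos_iff.1 (ha.trans hlt)
  have hw1 := hw.trans_lt hz
  have hfreq := frequently_norm_sub_lt hw0 (hdf w hw1) (hk _ (ha.trans hlt) hw1)
    (hk0 _ (ha.trans hlt) hw1) (hkf w hw0 hw1) (hh w hw0 hw1)
  have hnear : ∀ᶠ v in 𝓝 w, a < ‖v‖ := continuous_norm.continuousAt.eventually_const_lt hlt
  obtain ⟨v, ⟨hv1, hv2⟩, hv3⟩ := (hfreq.and_eventually hnear).exists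
  have hv : v ∈ Metric.closedBall (0 : ℂ) ‖z‖ ∩ {w | a ≤ ‖w‖} :=
    ⟨by simpa using (hv1.le.trans hw), hv3.le⟩
  exact absurd (hmin hv) (not_le.2 hv2)

/-- If `|f| ≥ k` on the circle of radius `r`, then the image under `f` of the disk of radius `r`
covers the disk of radius `k`. -/
theorem ball_subset_image {f : ℂ → ℂ} {r k : ℝ} (hr0 : 0 < r) (hr : r < 1)
    (hf : DifferentiableOn ℂ f unitDisk) (h0 : f 0 = 0)
    (hf' : ∀ z ∈ unitDisk, deriv f z ≠ 0) (hk : ∀ z, ‖z‖ = r → k ≤ ‖f z‖) :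
    Metric.ball 0 k ⊆ f '' unitDisk := by
  have hsub : Metric.closedBall (0 : ℂ) r ⊆ unitDisk := Metric.closedBall_subset_ball hr
  rcases le_or_gt k 0 with hk0 | hk0
  · rw [Metric.ball_eq_empty.2 hk0]; exact empty_subset _
  have hopen : IsOpen (f '' Metric.ball 0 r) := by
    rw [isOpen_iff_mem_nhds]
    rintro _ ⟨z, hz, rfl⟩
    have hzd : z ∈ unitDisk := hsub (Metric.ball_subset_closedBall hz)
    have hst : HasStrictDerivAt f (deriv f z) z :=
      (hf.analyticAt (unitDisk_mem_nhds (mem_unitDisk.1 hzd))).hasStrictDerivAt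
    rw [← hst.map_nhds_eq (hf' z hzd)]
    exact image_mem_map (Metric.isOpen_ball.mem_nhds hz)
  have hclosed : IsClosed (f '' Metric.closedBall 0 r) :=
    ((isCompact_closedBall 0 r).image_of_continuousOn (hf.continuousOn.mono hsub)).isClosed
  have hpre : IsPreconnected (Metric.ball (0 : ℂ) k) := (convex_ball 0 k).isPreconnected
  -- The connected ball of radius `k` misses the image of the circle, so it splits between the open
  -- image of the disk and the open complement of the compact image; containing `0 = f 0`, it lies
  -- in the former.
  have hcov : Metric.ball 0 k ⊆ f '' Metric.ball 0 r ∪ (f '' Metric.closedBall 0 r)ᶜ := by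
    intro w hw
    by_cases hwc : w ∈ f '' Metric.closedBall 0 r
    · left
      obtain ⟨z, hz, rfl⟩ := hwc
      refine ⟨z, ?_, rfl⟩
      rw [mem_closedBall_zero_iff] at hz
      rw [mem_ball_zero_iff] at hw ⊢
      exact lt_of_le_of_ne hz fun h => absurd (hk z h) (not_le.2 hw)
    · exact Or.inr hwc
  have hmem : (Metric.ball (0 : ℂ) k ∩ f '' Metric.ball 0 r).Nonempty :=
    ⟨0, by simpa using hk0, 0, by simpa using hr0, h0⟩
  have hdisj : Disjoint (f '' Metric.ball 0 r) (f '' Metric.closedBall 0 r)ᶜ :=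
    disjoint_compl_right.mono_left (image_mono Metric.ball_subset_closedBall)
  refine (hpre.subset_left_of_subset_union hopen hclosed.isOpen_compl hdisj hcov hmem).trans ?_
  exact image_mono (Metric.ball_subset_closedBall.trans hsub)

/-- Maximum principle for the real part of an analytic function on a closed disk. -/
theorem re_le_of_re_le_sphere {F : ℂ → ℂ} {r M : ℝ} (hF : ∀ w, ‖w‖ ≤ r → DifferentiableAt ℂ F w)
    (hM : ∀ w, ‖w‖ = r → (F w).re ≤ M) {z : ℂ} (hz : ‖z‖ ≤ r) : (F z).re ≤ M := by
  rcases eq_or_ne r 0 with rfl | hr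
  · exact hM z (le_antisymm hz (norm_nonneg z))
  have hd : DiffContOnCl ℂ (fun w => Complex.exp (F w)) (Metric.ball 0 r) := by
    apply DifferentiableOn.diffContOnCl
    intro w hw
    rw [closure_ball _ hr, mem_closedBall_zero_iff] at hw
    exact (hF w hw).cexp.differentiableWithinAt
  have := Complex.norm_le_of_forall_mem_frontier_norm_le Metric.isBounded_ball hd
    (C := Real.exp M) (fun w hw => by
      rw [frontier_ball _ hr, mem_sphere_zero_iff_norm] at hw
      rw [Complex.norm_exp]
      exact Real.exp_le_exp.2 (hM w hw))
    (z := z) (by rwa [closure_ball _ hr, mem_closedBall_zero_iff])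
  rwa [Complex.norm_exp, Real.exp_le_exp] at this

/-! ### The function `log K'` -/

/-- The derivative `2 (1 - γ) / ((1 - α t) (1 - β t))` of `log K'`. -/
def snailDQ (α β γ : ℝ) (t : ℂ) : ℂ :=
  2 * (1 - (γ : ℂ)) / ((1 - (α : ℂ) * t) * (1 - (β : ℂ) * t))

/-- The branch of `log K'` vanishing at the origin. -/
def snailQ (α β γ : ℝ) : ℂ → ℂ := segIntegral (snailDQ α β γ)

theorem one_sub_mul_ne_zero {a R : ℝ} (ha : |a| * R < 1) {z : ℂ} (hz : ‖z‖ ≤ R) :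
    1 - (a : ℂ) * z ≠ 0 := by
  intro h
  have h1 : ‖(a : ℂ) * z‖ = 1 := by rw [← sub_eq_zero.1 h]; simp
  rw [norm_mul, Complex.norm_real, Real.norm_eq_abs] at h1
  have : |a| * ‖z‖ ≤ |a| * R := by gcongr
  linarith

/-- The singularities `1/α` and `1/β` lie outside the closed disk, so `Q` and `K` are analytic
across the unit circle. This is what makes `K(-1)` meaningful. -/
theorem exists_one_lt_radius {α β : ℝ} (hα : |α| < 1) (hβ : |β| < 1) :
    ∃ R : ℝ, 1 < R ∧ |α| * R < 1 ∧ |β| * R < 1 := by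
  have h : ∀ a : ℝ, |a| < 1 → ∀ᶠ R : ℝ in 𝓝[>] 1, |a| * R < 1 := fun a ha => by
    have : Tendsto (fun R : ℝ => |a| * R) (𝓝[>] 1) (𝓝 (|a| * 1)) :=
      ((continuous_const.mul continuous_id).tendsto 1).mono_left nhdsWithin_le_nhds
    exact this.eventually_lt_const (by simpa using ha)
  obtain ⟨R, ⟨h1, h2⟩, h3⟩ := (((h α hα).and (h β hβ)).and self_mem_nhdsWithin).exists
  exact ⟨R, h3, h1, h2⟩

theorem differentiableAt_snailDQ {α β γ R : ℝ} (hα : |α| * R < 1) (hβ : |β| * R < 1) {z : ℂ}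
    (hz : ‖z‖ ≤ R) : DifferentiableAt ℂ (snailDQ α β γ) z := by
  unfold snailDQ
  refine DifferentiableAt.div (by fun_prop) (by fun_prop) ?_
  exact mul_ne_zero (one_sub_mul_ne_zero hα hz) (one_sub_mul_ne_zero hβ hz)

section Analytic

variable {α β γ : ℝ}

theorem hasDerivAt_snailQ (hα : |α| < 1) (hβ : |β| < 1) {z : ℂ} (hz : ‖z‖ ≤ 1) :
    HasDerivAt (snailQ α β γ) (snailDQ α β γ z) z := by
  obtain ⟨R, hR, h1, h2⟩ := exists_one_lt_radius hα hβ
  refine hasDerivAt_segIntegral (R := R) (fun w hw => ?_) (by simpa using hz.trans_lt hR)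
  exact (differentiableAt_snailDQ h1 h2
    (by simpa using (mem_ball_zero_iff.1 hw).le)).differentiableWithinAt

theorem snailK_eq : snailK α β γ = segIntegral (fun w => Complex.exp (snailQ α β γ w)) := rfl

theorem hasDerivAt_snailK (hα : |α| < 1) (hβ : |β| < 1) {z : ℂ} (hz : ‖z‖ ≤ 1) :
    HasDerivAt (snailK α β γ) (Complex.exp (snailQ α β γ z)) z := by
  obtain ⟨R, hR, h1, h2⟩ := exists_one_lt_radius hα hβ
  have hQ : DifferentiableOn ℂ (snailQ α β γ) (Metric.ball 0 R) := fun w hw =>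
    (hasDerivAt_segIntegral (R := R) (fun v hv => (differentiableAt_snailDQ h1 h2
      (by simpa using (mem_ball_zero_iff.1 hv).le)).differentiableWithinAt)
      hw).differentiableAt.differentiableWithinAt
  exact hasDerivAt_segIntegral hQ.cexp (by simpa using hz.trans_lt hR)

theorem deriv_snailK (hα : |α| < 1) (hβ : |β| < 1) {z : ℂ} (hz : ‖z‖ ≤ 1) :
    deriv (snailK α β γ) z = Complex.exp (snailQ α β γ z) :=
  (hasDerivAt_snailK hα hβ hz).deriv

theorem snailQ_zero : snailQ α β γ 0 = 0 := segIntegral_zero _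

theorem snailK_zero : snailK α β γ 0 = 0 := segIntegral_zero _

theorem snailQ_conj (z : ℂ) :
    snailQ α β γ ((starRingEnd ℂ) z) = (starRingEnd ℂ) (snailQ α β γ z) :=
  segIntegral_conj (fun z => by simp [snailDQ, map_ofNat]) z

theorem snailK_conj (z : ℂ) :
    snailK α β γ ((starRingEnd ℂ) z) = (starRingEnd ℂ) (snailK α β γ z) := by
  rw [snailK_eq]
  exact segIntegral_conj (fun z => by rw [snailQ_conj, Complex.exp_conj]) z

theorem snailQ_ofReal_im (x : ℝ) : (snailQ α β γ x).im = 0 := by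
  rw [← Complex.conj_eq_iff_im, ← snailQ_conj, Complex.conj_ofReal]

theorem snailK_ofReal_im (x : ℝ) : (snailK α β γ x).im = 0 := by
  rw [← Complex.conj_eq_iff_im, ← snailK_conj, Complex.conj_ofReal]

theorem exp_snailQ_ofReal (x : ℝ) :
    Complex.exp (snailQ α β γ x) = (Real.exp (snailQ α β γ x).re : ℝ) := by
  rw [Complex.ofReal_exp]
  congr 1
  exact Complex.ext (by simp) (by simpa using snailQ_ofReal_im x)

theorem snailL_eq (z : ℂ) : snailL α β γ z = z * snailDQ α β γ z := by
  unfold snailL snailDQ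
  ring

/-! ### Positivity of the real part of `𝒯` -/

/-- The inequality `2 (1 - γ) (α + β - (1 + α β) x) ≤ |(1 - α z)(1 - β z)|²` for `|z| = 1` and
`x = Re z`, which expresses that `Re 𝒯 ≥ 0` on the unit circle. -/
theorem snailT0_quadratic (hα : -1 < α) (hαβ : α ≤ β) (hβ : β < 1) (hγ1 : γ < 1)
    (hγT : snailT0 α β ≤ γ) {x : ℝ} (hx : -1 ≤ x) (hx1 : x ≤ 1) :
    2 * (1 - γ) * (α + β - (1 + α * β) * x) ≤
      (1 + α ^ 2 - 2 * α * x) * (1 + β ^ 2 - 2 * β * x) := by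
  have hα1 : α < 1 := hαβ.trans_lt hβ
  have hβ1 : -1 < β := hα.trans_le hαβ
  have hA : 0 ≤ 1 + α ^ 2 - 2 * α * x := by nlinarith [sq_nonneg (α - x)]
  have hB : 0 ≤ 1 + β ^ 2 - 2 * β * x := by nlinarith [sq_nonneg (β - x)]
  rcases le_or_gt (α + β - (1 + α * β) * x) 0 with hs | hs
  · have := mul_nonneg hA hB
    have : 2 * (1 - γ) * (α + β - (1 + α * β) * x) ≤ 0 :=
      mul_nonpos_of_nonneg_of_nonpos (by linarith) hs
    linarith
  have hp1 : 0 < 1 + α * β := by nlinarith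
  have hp2 : 0 < 1 - α * β := by nlinarith
  have hq1 : 0 < (1 - α) * (1 - β) := mul_pos (by linarith) (by linarith)
  by_cases hB1 : (α, β) ∈ regionB1
  · rw [snailT0, if_pos hB1] at hγT
    obtain ⟨hα0, -, -, -⟩ := hB1
    have hα0 : 0 < α := hα0
    have hβ0 : 0 < β := hα0.trans_le hαβ
    have hp : 0 < α * β := mul_pos hα0 hβ0
    have hD : 0 ≤ α * β * (1 - α ^ 2) * (1 - β ^ 2) :=
      mul_nonneg (mul_nonneg hp.le (by nlinarith)) (by nlinarith)
    set S := Real.sqrt (α * β * (1 - α ^ 2) * (1 - β ^ 2)) with hS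
    have hSS : S ^ 2 = α * β * (1 - α ^ 2) * (1 - β ^ 2) := Real.sq_sqrt hD
    set c := 2 * ((1 - α * β) * (2 * S + (α + β) * (1 - α * β)) / (1 + α * β) ^ 2) with hc
    have hcle : 2 * (1 - γ) ≤ c := by rw [hc]; linarith
    refine (mul_le_mul_of_nonneg_right hcle hs.le).trans ?_
    have hcX : c * (1 + α * β) ^ 2 = 2 * (1 - α * β) * (2 * S + (α + β) * (1 - α * β)) := by
      rw [hc]; field_simp
    -- In this region `𝒯₀` is the value of `γ` at which the quadratic in `x` has zero discriminant,
    -- so `16 α β` times it is a perfect square.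
    have hdisc : ((c - 2 * (α + β)) * (1 + α * β)) ^ 2 =
        16 * (α * β) * ((1 + α ^ 2) * (1 + β ^ 2) - c * (α + β)) := by
      have h1 : (c * (1 + α * β) ^ 2 - 2 * (α + β) * (1 - α * β) ^ 2) ^ 2 =
          16 * (1 - α * β) ^ 2 * (α * β * (1 - α ^ 2) * (1 - β ^ 2)) := by
        rw [hcX, ← hSS]; ring
      have h2 : (1 + α * β) ^ 2 * (((c - 2 * (α + β)) * (1 + α * β)) ^ 2 -
          16 * (α * β) * ((1 + α ^ 2) * (1 + β ^ 2) - c * (α + β))) = 0 := by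
        linear_combination h1
      have := (mul_eq_zero.1 h2).resolve_left (by positivity)
      linarith
    have h16 : 0 ≤ 16 * (α * β) * ((1 + α ^ 2 - 2 * α * x) * (1 + β ^ 2 - 2 * β * x) -
        c * (α + β - (1 + α * β) * x)) := by
      have := sq_nonneg (8 * (α * β) * x + (c - 2 * (α + β)) * (1 + α * β))
      linarith
    have := nonneg_of_mul_nonneg_right h16 (by positivity)
    linarith
  · rw [snailT0, if_neg hB1] at hγT
    have hcle : 2 * (1 - γ) ≤ (1 + α) * (1 + β) := by linarith
    refine (mul_le_mul_of_nonneg_right hcle hs.le).trans ?_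
    -- For the extreme `γ` the quadratic vanishes at `x = -1`. The remaining factor is affine in
    -- `x`, so its values at `x = ±1` decide the sign; this is the condition at `x = -1`. For `α >
    -- 0`, `β₁(α)` is the positive root in `β` of the corresponding equality.
    have hlow : 8 * (α * β) ≤ (1 - α) * (1 - β) * (1 + α * β) := by
      rcases le_or_gt (α * β) 0 with hp | hp
      · have := mul_pos hq1 hp1
        linarith
      rcases le_or_gt α 0 with hα0 | hα0
      · have hα0' : α < 0 := lt_of_le_of_ne hα0 (by rintro rfl; simp at hp)
        have hβ0 : β < 0 := by nlinarith
        refine abs_le_of_sq_le_sq' ?_ (mul_pos hq1 hp1).le |>.2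
        have e1 : 4 * -α ≤ (1 - α) ^ 2 := by nlinarith [sq_nonneg (1 + α)]
        have e2 : 4 * -β ≤ (1 - β) ^ 2 := by nlinarith [sq_nonneg (1 + β)]
        have e3 : 4 * (α * β) ≤ (1 + α * β) ^ 2 := by nlinarith [sq_nonneg (1 - α * β)]
        calc (8 * (α * β)) ^ 2 = (4 * -α) * (4 * -β) * (4 * (α * β)) := by ring
          _ ≤ (1 - α) ^ 2 * (1 - β) ^ 2 * (1 + α * β) ^ 2 := by
            apply mul_le_mul _ e3 (by positivity) (by positivity)
            exact mul_le_mul e1 e2 (by linarith) (by positivity)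
          _ = ((1 - α) * (1 - β) * (1 + α * β)) ^ 2 := by ring
      · have hβ1' : β ≤ betaOne α := by
          by_contra! hcon
          exact hB1 ⟨hα0, hα1, hcon, hβ⟩
        have hβ0 : 0 < β := hα0.trans_le hαβ
        have hden : 0 < 2 * α * (1 - α) := mul_pos (by linarith) (by linarith)
        rw [betaOne, le_div_iff₀ hden] at hβ1'
        have h1 : (β * (2 * α * (1 - α)) + (α ^ 2 + 6 * α + 1)) ^ 2 ≤
            ((1 + α) * Real.sqrt (α ^ 2 + 14 * α + 1)) ^ 2 := by
          have : 0 ≤ β * (2 * α * (1 - α)) := by positivity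
          exact pow_le_pow_left₀ (by positivity) (by linarith) 2
        rw [mul_pow, Real.sq_sqrt (by positivity)] at h1
        have h2 : 0 ≤ (2 * (2 * α * (1 - α))) *
            ((1 - α) * (1 - β) * (1 + α * β) - 8 * (α * β)) := by linarith
        have := nonneg_of_mul_nonneg_right h2 (by linarith)
        linarith
    have hlin : 0 ≤ 4 * (α * β) * x + ((1 - α) * (1 - β) * (1 + α * β) - 4 * (α * β)) := by
      have h1 := mul_nonneg (by linarith : (0 : ℝ) ≤ 1 + x) (mul_pos hq1 hp1).le
      have h2 := mul_nonneg (by linarith : (0 : ℝ) ≤ 1 - x) (sub_nonneg.2 hlow)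
      linarith
    have := mul_nonneg (by linarith : (0 : ℝ) ≤ 1 + x) hlin
    linarith

theorem differentiableAt_snailT (hα : |α| < 1) (hβ : |β| < 1) {z : ℂ} (hz : ‖z‖ ≤ 1) :
    DifferentiableAt ℂ (snailT α β γ) z := by
  have : snailT α β γ = fun z => 1 + z * snailDQ α β γ z := by
    ext z; rw [snailT, snailL_eq]
  rw [this]
  exact (differentiableAt_id.mul (differentiableAt_snailDQ (R := 1) (by simpa) (by simpa)
    hz)).const_add 1

theorem snailT_re_nonneg_of_norm_eq_one (hα : -1 < α) (hαβ : α ≤ β) (hβ : β < 1) (hγ1 : γ < 1)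
    (hγT : snailT0 α β ≤ γ) {z : ℂ} (hz : ‖z‖ = 1) : 0 ≤ (snailT α β γ z).re := by
  have hα' : |α| < 1 := abs_lt.2 ⟨hα, hαβ.trans_lt hβ⟩
  have hβ' : |β| < 1 := abs_lt.2 ⟨hα.trans_le hαβ, hβ⟩
  have hn : z.re * z.re + z.im * z.im = 1 := by
    have := Complex.normSq_eq_norm_sq z
    rw [hz, Complex.normSq_apply] at this
    linarith
  have hden : (1 - (α : ℂ) * z) * (1 - (β : ℂ) * z) ≠ 0 :=
    mul_ne_zero (one_sub_mul_ne_zero (R := 1) (by simpa) hz.le)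
      (one_sub_mul_ne_zero (R := 1) (by simpa) hz.le)
  have hsq : ∀ a : ℝ, Complex.normSq (1 - (a : ℂ) * z) = 1 + a ^ 2 - 2 * a * z.re := by
    intro a
    rw [Complex.normSq_apply]
    simp
    linear_combination a ^ 2 * hn
  have hpos := Complex.normSq_pos.2 hden
  have hx := abs_le.1 ((Complex.abs_re_le_norm z).trans hz.le)
  have hkey := snailT0_quadratic hα hαβ hβ hγ1 hγT hx.1 hx.2
  rw [Complex.normSq_mul, hsq, hsq] at hpos
  have hre : (snailT α β γ z).re = 1 + 2 * (1 - γ) * ((1 + α * β) * z.re - (α + β)) /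
      ((1 + α ^ 2 - 2 * α * z.re) * (1 + β ^ 2 - 2 * β * z.re)) := by
    rw [snailT, snailL, Complex.add_re, Complex.one_re, Complex.div_re, ← add_div,
      Complex.normSq_mul, hsq, hsq]
    congr 2
    simp
    linear_combination (2 * (1 - γ) * (α * β * z.re - (α + β))) * hn
  rw [hre, ← neg_le_iff_add_nonneg', ← neg_le_neg_iff, neg_neg, ← neg_div, div_le_one hpos]
  linarith

/-- The circle estimate passes to the disk by the maximum principle. An interior point with
nonpositive real part would be a maximum of `|exp(-𝒯)|`, forcing constancy of `exp(-𝒯)`, against `𝒯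
0 = 1`. -/
theorem snailT_re_pos (hα : -1 < α) (hαβ : α ≤ β) (hβ : β < 1) (hγ1 : γ < 1)
    (hγT : snailT0 α β ≤ γ) {z : ℂ} (hz : ‖z‖ < 1) : 0 < (snailT α β γ z).re := by
  have hα' : |α| < 1 := abs_lt.2 ⟨hα, hαβ.trans_lt hβ⟩
  have hβ' : |β| < 1 := abs_lt.2 ⟨hα.trans_le hαβ, hβ⟩
  have hnn : ∀ w : ℂ, ‖w‖ ≤ 1 → (-snailT α β γ w).re ≤ 0 := fun w hw =>
    re_le_of_re_le_sphere (F := fun w => -snailT α β γ w)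
      (fun w hw => (differentiableAt_snailT hα' hβ' hw).neg)
      (fun w hw => by simpa using snailT_re_nonneg_of_norm_eq_one hα hαβ hβ hγ1 hγT hw) hw
  by_contra! hcon
  have hmax : IsMaxOn (norm ∘ fun w => Complex.exp (-snailT α β γ w)) unitDisk z := by
    intro w hw
    simp only [Function.comp, mem_ofPred_eq, Complex.norm_exp]
    have := hnn w (mem_unitDisk.1 hw).le
    apply Real.exp_le_exp.2
    rw [Complex.neg_re] at this ⊢
    rw [Complex.neg_re]
    linarith
  have hd : DifferentiableOn ℂ (fun w => Complex.exp (-snailT α β γ w)) unitDisk := fun w hw =>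
    (differentiableAt_snailT hα' hβ' (mem_unitDisk.1 hw).le).neg.cexp.differentiableWithinAt
  have := Complex.eqOn_of_isPreconnected_of_isMaxOn_norm (convex_ball 0 1).isPreconnected
    isOpen_unitDisk hd (mem_unitDisk.2 hz) hmax zero_mem_unitDisk
  have h2 := congrArg norm this
  simp only [Function.const, Complex.norm_exp, Real.exp_eq_exp, Complex.neg_re] at h2
  simp only [snailT, snailL, mul_zero, zero_div, add_zero, Complex.one_re] at h2
  simp only [snailT, snailL] at hcon
  linarith

/-! ### Starlikeness of `𝔏` and subordination of primitives -/

/-- The image of the unit disk under `w / ((1 - α w) (1 - β w))` is starlike: no value on the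
boundary curve, stretched by a factor `m ≥ 1`, is attained in the open disk. -/
theorem snailDQ_starlike (hα : |α| < 1) (hβ : |β| < 1) (hγ : γ < 1) {ζ w : ℂ} {m : ℝ}
    (hm : 1 ≤ m) (hζ : ‖ζ‖ = 1) (hw : ‖w‖ < 1) :
    m * (ζ * snailDQ α β γ ζ) ≠ w * snailDQ α β γ w := by
  intro heq
  rw [abs_lt] at hα hβ
  have hα' : |α| < 1 := abs_lt.2 hα
  have hβ' : |β| < 1 := abs_lt.2 hβ
  have e1 := one_sub_mul_ne_zero (R := 1) (by simpa using hα') hζ.le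
  have e2 := one_sub_mul_ne_zero (R := 1) (by simpa using hβ') hζ.le
  have e3 := one_sub_mul_ne_zero (R := 1) (by simpa using hα') hw.le
  have e4 := one_sub_mul_ne_zero (R := 1) (by simpa using hβ') hw.le
  have hC : (2 * (1 - (γ : ℂ))) ≠ 0 := by
    have : ((2 * (1 - γ) : ℝ) : ℂ) ≠ 0 := Complex.ofReal_ne_zero.2 (by linarith)
    simpa using this
  have hpoly : w * ((1 - α * ζ) * (1 - β * ζ)) = m * ζ * ((1 - α * w) * (1 - β * w)) := by
    unfold snailDQ at heq
    rw [← mul_div_assoc, ← mul_div_assoc, ← mul_div_assoc,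
      div_eq_div_iff (mul_ne_zero e1 e2) (mul_ne_zero e3 e4)] at heq
    apply mul_left_cancel₀ hC
    linear_combination -heq
  have hm0 : 0 < m := by linarith
  have hζ0 : ζ ≠ 0 := norm_pos_iff.1 (by rw [hζ]; exact one_pos)
  have hw0 : w ≠ 0 := by
    rintro rfl
    simp [hζ0, hm0.ne'] at hpoly
  have hxy : ζ.re ^ 2 + ζ.im ^ 2 = 1 := by
    have := Complex.normSq_eq_norm_sq ζ
    rw [hζ, Complex.normSq_apply] at this
    linarith
  have hpabs : |α * β| < 1 := by
    rw [abs_mul]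
    exact mul_lt_one_of_nonneg_of_lt_one_left (abs_nonneg α) hα' hβ'.le
  have hp1 : 0 < 1 + α * β := by linarith [(abs_lt.1 hpabs).1]
  have hp2 : 0 < 1 - α * β := by linarith [(abs_lt.1 hpabs).2]
  set n := w.re ^ 2 + w.im ^ 2 with hn
  have hnn : n = ‖w‖ ^ 2 := by
    rw [← Complex.normSq_eq_norm_sq, Complex.normSq_apply]; ring
  have hn0 : 0 < n := by rw [hnn]; have := norm_pos_iff.2 hw0; positivity
  have hn1 : n < 1 := by rw [hnn]; nlinarith [norm_nonneg w]
  have hζζ : ζ * (starRingEnd ℂ) ζ = 1 := by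
    rw [Complex.mul_conj, Complex.normSq_eq_norm_sq, hζ]; simp
  have hww : w * (starRingEnd ℂ) w = n := by
    rw [Complex.mul_conj, Complex.normSq_eq_norm_sq, hnn]
  -- Taking reciprocals and using `1/z = conj z / |z|²` turns the equation into `t E(ζ) = E(w)`,
  -- where `E(z) = 1/z - s + p z` and `t = 1/m`. `E` maps the unit circle to an ellipse centred at
  -- `-s` with semi-axes `1 + p` and `1 - p`.
  have hellipse : (n : ℂ) * ((starRingEnd ℂ) ζ - (α + β) + α * β * ζ) =
      m * ((starRingEnd ℂ) w - (α + β) * n + α * β * n * w) := by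
    linear_combination ((starRingEnd ℂ) w * (starRingEnd ℂ) ζ) * hpoly +
      (m * (starRingEnd ℂ) w * ((1 - α * w) * (1 - β * w)) +
        n * (α + β - α * β * ζ)) * hζζ -
      ((starRingEnd ℂ) ζ * (1 - α * ζ) * (1 - β * ζ) + m * (α + β - α * β * w)) * hww
  have hre := congrArg Complex.re hellipse
  have him := congrArg Complex.im hellipse
  simp at hre him
  -- The origin lies inside this ellipse because `(1+p)² - s² = (1-α²)(1-β²) > 0`. By convexity `t
  -- E(ζ)` stays inside (`c1`, `c2`), whereas `E(w)` lies on a strictly larger concentric ellipse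
  -- (`k1`, `k2`).
  set p := α * β with hp
  set s := α + β with hs
  have hs1 : s ^ 2 < (1 + p) ^ 2 := by
    have : 0 < (1 - α) * (1 + α) * ((1 - β) * (1 + β)) := by
      apply mul_pos <;> apply mul_pos <;> linarith
    rw [hs, hp]; linarith
  set t := 1 / m with ht
  have ht0 : 0 < t := by positivity
  have ht1 : t ≤ 1 := by rw [ht, div_le_one hm0]; exact hm
  have htm : t * m = 1 := by rw [ht]; field_simp
  have ea : w.re * (1 + p * n) = n * (t * ((1 + p) * ζ.re) + (1 - t) * s) := by
    linear_combination (-t) * hre + (-(w.re * (1 + p * n)) + n * s) * htm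
  have eb : w.im * (1 - p * n) = n * (t * ((1 - p) * ζ.im)) := by
    linear_combination t * him - w.im * (1 - p * n) * htm
  have hpp : 0 < (1 - n) * (1 - p ^ 2 * n) := by
    have := mul_pos (mul_pos hp1 hp2) hn0
    exact mul_pos (by linarith) (by linarith)
  have k1 : n * (1 + p) ^ 2 < (1 + p * n) ^ 2 := by linarith
  have k2 : n * (1 - p) ^ 2 < (1 - p * n) ^ 2 := by linarith
  have c1 : (t * ((1 + p) * ζ.re) + (1 - t) * s) ^ 2 ≤
      (1 + p) ^ 2 * (t * ζ.re ^ 2 + (1 - t)) := by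
    have h1 : 0 ≤ t * (1 - t) * ((1 + p) * ζ.re - s) ^ 2 := by
      have := sub_nonneg.2 ht1; positivity
    have h2 : 0 ≤ (1 - t) * ((1 + p) ^ 2 - s ^ 2) :=
      mul_nonneg (sub_nonneg.2 ht1) (by linarith)
    linarith
  have c2 : (t * ((1 - p) * ζ.im)) ^ 2 ≤ (1 - p) ^ 2 * (t * ζ.im ^ 2) := by
    have : 0 ≤ t * (1 - t) * ((1 - p) * ζ.im) ^ 2 := by
      have := sub_nonneg.2 ht1; positivity
    linarith
  have d1 : w.re ^ 2 * (1 + p * n) ^ 2 ≤ n ^ 2 * ((1 + p) ^ 2 * (t * ζ.re ^ 2 + (1 - t))) := by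
    rw [← mul_pow, ea, mul_pow]; gcongr
  have d2 : w.im ^ 2 * (1 - p * n) ^ 2 ≤ n ^ 2 * ((1 - p) ^ 2 * (t * ζ.im ^ 2)) := by
    rw [← mul_pow, eb, mul_pow]; gcongr
  have f1 : w.re ^ 2 ≤ n * (t * ζ.re ^ 2 + (1 - t)) ∧
      (w.re ≠ 0 → w.re ^ 2 < n * (t * ζ.re ^ 2 + (1 - t))) := by
    have hpos : 0 < n * (1 + p) ^ 2 := by positivity
    constructor
    · refine le_of_mul_le_mul_left ?_ hpos
      have := mul_le_mul_of_nonneg_left k1.le (sq_nonneg w.re)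
      linarith
    · intro h0
      refine lt_of_mul_lt_mul_left ?_ hpos.le
      have := mul_lt_mul_of_pos_left k1 (by positivity : 0 < w.re ^ 2)
      linarith
  have f2 : w.im ^ 2 ≤ n * (t * ζ.im ^ 2) ∧ (w.im ≠ 0 → w.im ^ 2 < n * (t * ζ.im ^ 2)) := by
    have hpos : 0 < n * (1 - p) ^ 2 := by positivity
    constructor
    · refine le_of_mul_le_mul_left ?_ hpos
      have := mul_le_mul_of_nonneg_left k2.le (sq_nonneg w.im)
      linarith
    · intro h0
      refine lt_of_mul_lt_mul_left ?_ hpos.le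
      have := mul_lt_mul_of_pos_left k2 (by positivity : 0 < w.im ^ 2)
      linarith
  have hsum : n * (t * ζ.re ^ 2 + (1 - t)) + n * (t * ζ.im ^ 2) = n := by
    linear_combination n * t * hxy
  by_cases h0 : w.re = 0
  · have him0 : w.im ≠ 0 := fun h => hw0 (Complex.ext h0 h)
    linarith [f1.1, f2.2 him0]
  · linarith [f1.2 h0, f2.1]

/-- A solution of `N' = 1 + δ N` with `N 0 = 0`, for all `δ` including `0`. -/
theorem exists_primitive_one_add_mul (δ : ℂ) :
    ∃ N : ℂ → ℂ, N 0 = 0 ∧ ∀ u, HasDerivAt N (1 + δ * N u) u := by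
  by_cases hδ : δ = 0
  · exact ⟨id, rfl, fun u => by simpa [hδ] using hasDerivAt_id u⟩
  · refine ⟨fun u => (Complex.exp (δ * u) - 1) / δ, by simp, fun u => ?_⟩
    have := ((((hasDerivAt_id u).const_mul δ).cexp).sub_const 1).div_const δ
    refine this.congr_deriv ?_
    simp only [id]
    field_simp
    ring

/-- **Suffridge's theorem** for the starlike function `𝔏`: if `z g' = 𝔏 ∘ φ`, then `g ≺ log K'`. -/
theorem subordinate_snailQ (hα : |α| < 1) (hβ : |β| < 1) (hγ : γ < 1) {g g' φ : ℂ → ℂ}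
    (hg : ∀ z ∈ unitDisk, HasDerivAt g (g' z) z) (hg0 : g 0 = 0)
    (hφ : MapsTo φ unitDisk unitDisk)
    (heq : ∀ z ∈ unitDisk, z * g' z = snailL α β γ (φ z)) :
    Subordinate g (snailQ α β γ) := by
  obtain ⟨C, hCdef⟩ : ∃ C : ℂ, C = 2 * (1 - (γ : ℂ)) := ⟨_, rfl⟩
  have hC : C ≠ 0 := by
    have : ((2 * (1 - γ) : ℝ) : ℂ) ≠ 0 := Complex.ofReal_ne_zero.2 (by linarith)
    simpa [hCdef] using this
  -- The Möbius coordinate `U = C ω/(1 - β ω)` satisfies `dU/dQ = 1 + δ U`. So `U = N(g)` is entire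
  -- in `g`, even when `α = β`, and `ω = U/(C + β U)` is an explicit form of `Q⁻¹ ∘ g`.
  obtain ⟨δ, hδC⟩ : ∃ δ : ℂ, δ * C = β - α := ⟨(β - α) / C, div_mul_cancel₀ _ hC⟩
  obtain ⟨N, hN0, hN⟩ := exists_primitive_one_add_mul δ
  set U : ℂ → ℂ := fun z => N (g z) with hU
  have hU0 : U 0 = 0 := by simp [hU, hg0, hN0]
  have hUd : ∀ z ∈ unitDisk, HasDerivAt U ((1 + δ * U z) * g' z) z := fun z hz =>
    (hN (g z)).comp z (hg z hz)
  set ω : ℂ → ℂ := fun z => U z / (C + β * U z) with hω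
  have hω0 : ω 0 = 0 := by simp [hω, hU0]
  have hωd : ∀ z ∈ unitDisk, C + β * U z ≠ 0 →
      HasDerivAt ω (C * ((1 + δ * U z) * g' z) / (C + β * U z) ^ 2) z := by
    intro z hz hne
    have := (hUd z hz).div (((hUd z hz).const_mul (β : ℂ)).const_add C) hne
    refine this.congr_deriv ?_
    ring
  have hωU : ∀ z, C + β * U z ≠ 0 → ω z * (C + β * U z) = U z := fun z hne =>
    div_mul_cancel₀ _ hne
  have hDQ : ∀ z ∈ unitDisk, C + β * U z ≠ 0 → ‖ω z‖ ≤ 1 →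
      C * ((1 + δ * U z) * g' z) / (C + β * U z) ^ 2 * snailDQ α β γ (ω z) = g' z := by
    intro z _ hne hle
    have h1 : 1 - (α : ℂ) * ω z = C * (1 + δ * U z) / (C + β * U z) := by
      rw [eq_div_iff hne, sub_mul, one_mul, mul_assoc, hωU z hne]
      linear_combination (-U z) * hδC
    have h2 : 1 - (β : ℂ) * ω z = C / (C + β * U z) := by
      rw [eq_div_iff hne, sub_mul, one_mul, mul_assoc, hωU z hne]
      ring
    have h3 := one_sub_mul_ne_zero (R := 1) (by simpa using hα) hle
    rw [h1] at h3
    have h4 : 1 + δ * U z ≠ 0 := by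
      intro h
      rw [h] at h3
      simp at h3
    rw [snailDQ, h1, h2, ← hCdef]
    generalize C + β * U z = V at hne
    field_simp
  have hlt_ne : ∀ z, ‖U z‖ ≤ ‖C + β * U z‖ → C + β * U z ≠ 0 := by
    intro z hle h0
    rw [h0, norm_zero, norm_le_zero_iff] at hle
    rw [hle] at h0
    simp [hC] at h0
  -- This says `|ω| < 1` without dividing, so that possible poles of `ω` are excluded too. At a
  -- failure of least modulus, Jack's lemma gives `z ω' = m ω`, hence `m 𝔏(ω z) = 𝔏(φ z)` with `|ω
  -- z| = 1`, contradicting starlikeness.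
  have hW : ∀ z ∈ unitDisk, ‖U z‖ < ‖C + β * U z‖ := by
    by_contra! hcon
    obtain ⟨z₁, hz₁, hbad⟩ := hcon
    rw [mem_unitDisk] at hz₁
    have hcontU : ContinuousOn U (Metric.closedBall 0 ‖z₁‖) := fun z hz =>
      (hUd z (mem_unitDisk.2 ((mem_closedBall_zero_iff.1 hz).trans_lt
        hz₁))).continuousAt.continuousWithinAt
    have hcont : ContinuousOn (fun z => ‖C + β * U z‖ - ‖U z‖) (Metric.closedBall 0 ‖z₁‖) :=
      (continuousOn_const.add (continuousOn_const.mul hcontU)).norm.sub hcontU.norm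
    have hcl : IsCompact (Metric.closedBall (0 : ℂ) ‖z₁‖ ∩
        (fun z => ‖C + β * U z‖ - ‖U z‖) ⁻¹' Iic 0) :=
      (isCompact_closedBall 0 ‖z₁‖).of_isClosed_subset
        (hcont.preimage_isClosed_of_isClosed Metric.isClosed_closedBall isClosed_Iic)
        inter_subset_left
    obtain ⟨z, ⟨hzb, hzn⟩, hmin⟩ := hcl.exists_isMinOn
      ⟨z₁, by simp, sub_nonpos.2 hbad⟩ continuous_norm.continuousOn
    rw [mem_closedBall_zero_iff] at hzb
    have hzn : ‖C + β * U z‖ ≤ ‖U z‖ := sub_nonpos.1 hzn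
    have hzd : z ∈ unitDisk := mem_unitDisk.2 (hzb.trans_lt hz₁)
    have hgood : ∀ w, ‖w‖ < ‖z‖ → ‖U w‖ < ‖C + β * U w‖ := by
      intro w hw
      by_contra! hw'
      exact absurd (hmin (show w ∈ _ from ⟨by simpa using hw.le.trans hzb, sub_nonpos.2 hw'⟩))
        (not_le.2 hw)
    have hz0 : z ≠ 0 := by
      rintro rfl
      simp [hU0, hC] at hzn
    have hge : ‖U z‖ ≤ ‖C + β * U z‖ := by
      have hline : Tendsto (fun t : ℝ => U (z * (1 + t * (-1)))) (𝓝[>] 0) (𝓝 (U z)) := by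
        have := (hasDerivAt_along_line (d := -1) (hUd z hzd)).continuousAt.tendsto.mono_left
          (nhdsWithin_le_nhds (s := Ioi 0))
        simpa using this
      refine le_of_tendsto_of_tendsto hline.norm ((hline.const_mul (β : ℂ)).const_add C).norm ?_
      filter_upwards [eventually_norm_mul_lt (d := -1) hz0 (by simp)] with t ht
      exact (hgood _ ht).le
    have hne := hlt_ne z hge
    have hone : ‖ω z‖ = 1 := by
      simp only [hω]
      rw [norm_div, le_antisymm hge hzn, div_self (norm_ne_zero_iff.2 hne)]
    have hd := hωd z hzd hne
    have hsub : ∀ w, ‖w‖ < ‖z‖ → w ∈ unitDisk := fun w hw =>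
      mem_unitDisk.2 (hw.trans (mem_unitDisk.1 hzd))
    obtain ⟨m, hm1, hm⟩ := jack_lemma hz0
      (fun w hw => by
        have hw := mem_ball_zero_iff.1 hw
        exact (hωd w (hsub w hw)
          (hlt_ne w (hgood w hw).le)).differentiableAt.differentiableWithinAt)
      (fun w hw => by
        simp only [hω]
        rw [norm_div]
        exact div_le_one_of_le₀ (hgood w hw).le (norm_nonneg _)) hω0 hone hd
    refine snailDQ_starlike hα hβ hγ (γ := γ) hm1 hone (mem_unitDisk.1 (hφ hzd)) ?_
    rw [← snailL_eq (φ z), ← heq z hzd, ← mul_assoc, ← hm, mul_assoc, hDQ z hzd hne hone.le]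
  have hωlt : ∀ z ∈ unitDisk, ‖ω z‖ < 1 := by
    intro z hz
    simp only [hω]
    rw [norm_div]
    exact (div_lt_one ((norm_nonneg _).trans_lt (hW z hz))).2 (hW z hz)
  have hωD : ∀ z ∈ unitDisk,
      HasDerivAt ω (C * ((1 + δ * U z) * g' z) / (C + β * U z) ^ 2) z := fun z hz =>
    hωd z hz (hlt_ne z (hW z hz).le)
  have hder : ∀ z ∈ unitDisk, HasDerivAt (fun z => g z - snailQ α β γ (ω z)) 0 z := by
    intro z hz
    have h1 := (hasDerivAt_snailQ (γ := γ) hα hβ (hωlt z hz).le).comp z (hωD z hz)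
    rw [mul_comm, hDQ z hz (hlt_ne z (hW z hz).le) (hωlt z hz).le] at h1
    rw [← sub_self (g' z)]
    exact (hg z hz).sub h1
  refine ⟨ω, fun z hz => (hωD z hz).differentiableAt.differentiableWithinAt,
    fun z hz => mem_unitDisk.2 (hωlt z hz), hω0, fun z hz => ?_⟩
  have hconst := isOpen_unitDisk.is_const_of_deriv_eq_zero (convex_ball 0 1).isPreconnected
    (fun z hz => (hder z hz).differentiableAt.differentiableWithinAt)
    (fun z hz => (hder z hz).deriv) hz zero_mem_unitDisk
  simp only [hg0, hω0, snailQ_zero, sub_zero] at hconst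
  exact sub_eq_zero.1 hconst

/-! ### Extremal values of `log K'` on circles -/

/-- The numerator of the imaginary part is `(2 - 2γ) Im z (1 - αβ|z|²)`. -/
theorem snailL_im_nonneg (hα : |α| < 1) (hβ : |β| < 1) (hγ : γ < 1) {z : ℂ} (hz : ‖z‖ ≤ 1)
    (him : 0 ≤ z.im) : 0 ≤ (snailL α β γ z).im := by
  rw [abs_lt] at hα hβ
  have hn : z.re ^ 2 + z.im ^ 2 ≤ 1 := by
    have := Complex.normSq_eq_norm_sq z
    rw [Complex.normSq_apply] at this
    nlinarith [norm_nonneg z]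
  have hp : 0 ≤ 1 - α * β * (z.re ^ 2 + z.im ^ 2) := by
    have : α * β ≤ 1 := by nlinarith
    nlinarith [sq_nonneg z.re, sq_nonneg z.im]
  rw [snailL, Complex.div_im, ← sub_div]
  refine div_nonneg ?_ (Complex.normSq_nonneg _)
  have hC : 0 ≤ 2 - 2 * γ := by linarith
  have := mul_nonneg (mul_nonneg hC him) hp
  simp
  linarith

/-- Along the circle, the angular derivative of `Re Q` is `-Im 𝔏`, which is nonpositive on the upper
half; the lower half follows by conjugation. -/
theorem snailQ_re_mem_of_norm_eq (hα : |α| < 1) (hβ : |β| < 1) (hγ : γ < 1) {w : ℂ}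
    (hw : ‖w‖ ≤ 1) :
    (snailQ α β γ (-(‖w‖ : ℂ))).re ≤ (snailQ α β γ w).re ∧
      (snailQ α β γ w).re ≤ (snailQ α β γ (‖w‖ : ℂ)).re := by
  wlog him : 0 ≤ w.im generalizing w
  · have := this (w := (starRingEnd ℂ) w) (by simpa using hw) (by simp; linarith)
    simpa [snailQ_conj] using this
  set ρ := ‖w‖ with hρ
  set c : ℝ → ℂ := fun θ => ρ * Complex.exp (θ * Complex.I) with hc
  have hcn : ∀ θ, ‖c θ‖ ≤ 1 := fun θ => by
    simp only [hc]
    rw [norm_mul, Complex.norm_exp_ofReal_mul_I, mul_one, Complex.norm_real,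
      Real.norm_of_nonneg (norm_nonneg w)]
    exact hw
  have hder : ∀ θ, HasDerivAt (fun θ => (snailQ α β γ (c θ)).re)
      (-(snailL α β γ (c θ)).im) θ := by
    intro θ
    have h1 : HasDerivAt (fun τ : ℂ => (ρ : ℂ) * Complex.exp (τ * Complex.I))
        (c θ * Complex.I) (θ : ℂ) := by
      have := (((hasDerivAt_id (θ : ℂ)).mul_const Complex.I).cexp).const_mul (ρ : ℂ)
      simpa [hc, mul_assoc] using this
    have h2 := HasDerivAt.comp (θ : ℂ) (hasDerivAt_snailQ (γ := γ) hα hβ (hcn θ)) h1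
    have h3 := Complex.reCLM.hasFDerivAt.comp_hasDerivAt θ h2.comp_ofReal
    have h4 : Complex.reCLM (snailDQ α β γ (c θ) * (c θ * Complex.I)) =
        -(snailL α β γ (c θ)).im := by
      rw [snailL_eq, show snailDQ α β γ (c θ) * (c θ * Complex.I) =
        (c θ * snailDQ α β γ (c θ)) * Complex.I by ring, Complex.reCLM_apply, Complex.mul_I_re]
    rw [← h4]
    exact h3
  have hanti : AntitoneOn (fun θ => (snailQ α β γ (c θ)).re) (Icc 0 Real.pi) := by
    refine antitoneOn_of_deriv_nonpos (convex_Icc _ _)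
      (fun θ _ => (hder θ).continuousAt.continuousWithinAt)
      (fun θ _ => (hder θ).differentiableAt.differentiableWithinAt) (fun θ hθ => ?_)
    rw [interior_Icc] at hθ
    rw [(hder θ).deriv, neg_nonpos]
    refine snailL_im_nonneg hα hβ hγ (hcn θ) ?_
    simp only [hc]
    rw [Complex.im_ofReal_mul, Complex.exp_ofReal_mul_I_im]
    exact mul_nonneg (norm_nonneg w) (Real.sin_nonneg_of_nonneg_of_le_pi hθ.1.le hθ.2.le)
  have harg : 0 ≤ Complex.arg w ∧ Complex.arg w ≤ Real.pi :=
    ⟨Complex.arg_nonneg_iff.2 him, Complex.arg_le_pi w⟩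
  have hcw : c (Complex.arg w) = w := Complex.norm_mul_exp_arg_mul_I w
  have hc0 : c 0 = ρ := by simp [hc]
  have hcpi : c Real.pi = -(ρ : ℂ) := by simp [hc]
  have h1 := hanti ⟨le_rfl, Real.pi_pos.le⟩ harg harg.1
  have h2 := hanti harg ⟨Real.pi_pos.le, le_rfl⟩ harg.2
  simp only [hcw, hc0, hcpi] at h1 h2
  exact ⟨h2, h1⟩

theorem hasDerivAt_snailQ_re (hα : |α| < 1) (hβ : |β| < 1) {x : ℝ} (hx : |x| ≤ 1) :
    HasDerivAt (fun x : ℝ => (snailQ α β γ x).re) (snailDQ α β γ x).re x :=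
  (hasDerivAt_snailQ (γ := γ) hα hβ (z := x) (by simpa using hx)).real_of_complex

theorem hasDerivAt_snailK_re (hα : |α| < 1) (hβ : |β| < 1) {x : ℝ} (hx : |x| ≤ 1) :
    HasDerivAt (fun x : ℝ => (snailK α β γ x).re) (Real.exp (snailQ α β γ x).re) x := by
  have := (hasDerivAt_snailK (γ := γ) hα hβ (z := x) (by simpa using hx)).real_of_complex
  rwa [exp_snailQ_ofReal, Complex.ofReal_re] at this

theorem strictMonoOn_snailQ_re (hα : |α| < 1) (hβ : |β| < 1) (hγ : γ < 1) :
    StrictMonoOn (fun x : ℝ => (snailQ α β γ x).re) (Icc (-1) 1) := by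
  refine strictMonoOn_of_deriv_pos (convex_Icc _ _)
    (fun x hx => (hasDerivAt_snailQ_re hα hβ (abs_le.2 hx)).continuousAt.continuousWithinAt)
    (fun x hx => ?_)
  rw [interior_Icc] at hx
  have hx' : |x| < 1 := abs_lt.2 hx
  rw [(hasDerivAt_snailQ_re hα hβ hx'.le).deriv]
  have hpos : ∀ a : ℝ, |a| < 1 → 0 < 1 - a * x := fun a ha => by
    have : |a * x| < 1 := by
      rw [abs_mul]; nlinarith [abs_nonneg a, abs_nonneg x]
    linarith [(abs_lt.1 this).2]
  have h : snailDQ α β γ x = ((2 * (1 - γ) / ((1 - α * x) * (1 - β * x)) : ℝ) : ℂ) := by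
    simp [snailDQ]
  rw [h, Complex.ofReal_re]
  exact div_pos (by linarith) (mul_pos (hpos α hα) (hpos β hβ))

theorem snailQ_re_mem (hα : |α| < 1) (hβ : |β| < 1) (hγ : γ < 1) {w : ℂ} {r : ℝ}
    (hw : ‖w‖ ≤ r) (hr : r ≤ 1) :
    (snailQ α β γ (-(r : ℂ))).re ≤ (snailQ α β γ w).re ∧
      (snailQ α β γ w).re ≤ (snailQ α β γ (r : ℂ)).re := by
  obtain ⟨h1, h2⟩ := snailQ_re_mem_of_norm_eq hα hβ hγ (hw.trans hr)
  have hm := (strictMonoOn_snailQ_re (γ := γ) hα hβ hγ).monotoneOn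
  have h0 := norm_nonneg w
  have h3 := hm (a := -r) (b := -‖w‖) ⟨by linarith, by linarith⟩ ⟨by linarith, by linarith⟩
    (by linarith)
  have h4 := hm (a := ‖w‖) (b := r) ⟨by linarith, by linarith⟩ ⟨by linarith, by linarith⟩ hw
  simp only [Complex.ofReal_neg] at h3 h4
  exact ⟨h3.trans h1, h2.trans h4⟩

/-! ### Consequences for the class `CV_snail` -/

/-- Two functions with equal derivatives on the unit disk and equal values at `0` coincide. -/
theorem eqOn_unitDisk_of_hasDerivAt {f g d : ℂ → ℂ} (hf : ∀ z ∈ unitDisk, HasDerivAt f (d z) z)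
    (hg : ∀ z ∈ unitDisk, HasDerivAt g (d z) z) (h0 : f 0 = g 0) : ∀ z ∈ unitDisk, f z = g z := by
  intro z hz
  have hd : ∀ w ∈ unitDisk, HasDerivAt (fun w => f w - g w) 0 w := fun w hw => by
    rw [← sub_self (d w)]
    exact (hf w hw).sub (hg w hw)
  have := isOpen_unitDisk.is_const_of_deriv_eq_zero (convex_ball 0 1).isPreconnected
    (fun w hw => (hd w hw).differentiableAt.differentiableWithinAt)
    (fun w hw => (hd w hw).deriv) hz zero_mem_unitDisk
  simp only [h0, sub_self] at this
  exact sub_eq_zero.1 this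

theorem hasDerivAt_of_mem_unitDisk {f : ℂ → ℂ} (hf : DifferentiableOn ℂ f unitDisk) {z : ℂ}
    (hz : z ∈ unitDisk) : HasDerivAt f (deriv f z) z :=
  (hf.differentiableAt (unitDisk_mem_nhds (mem_unitDisk.1 hz))).hasDerivAt

/-- For `f` in the class, `log f'` is subordinate to `log K'`. -/
theorem exists_deriv_eq_exp_snailQ (hα : |α| < 1) (hβ : |β| < 1) (hγ : γ < 1) {f : ℂ → ℂ}
    (hf : f ∈ CVsnail α β γ) :
    ∃ ω : ℂ → ℂ, DifferentiableOn ℂ ω unitDisk ∧ MapsTo ω unitDisk unitDisk ∧ ω 0 = 0 ∧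
      ∀ z ∈ unitDisk, deriv f z = Complex.exp (snailQ α β γ (ω z)) := by
  obtain ⟨hfd, -, hf1, hf', φ, -, hφ, -, hsub⟩ := hf
  have hd1 : DifferentiableOn ℂ (deriv f) unitDisk := hfd.deriv isOpen_unitDisk
  have hd2 : DifferentiableOn ℂ (deriv (deriv f)) unitDisk := hd1.deriv isOpen_unitDisk
  have hex : Complex.IsExactOn (fun z => deriv (deriv f) z / deriv f z) unitDisk :=
    DifferentiableOn.isExactOn_ball (hd2.div hd1 hf')
  obtain ⟨g, hg0, hg⟩ := hex.with_val_at 0 0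
  -- The primitive `g` of `f''/f'` is a logarithm of `f'`, because `f' exp(-g)` has zero derivative.
  have hexp : ∀ z ∈ unitDisk, deriv f z * Complex.exp (-g z) = 1 := by
    refine eqOn_unitDisk_of_hasDerivAt (d := fun _ => 0) (fun z hz => ?_)
      (fun z hz => hasDerivAt_const z 1) (by simp [hg0, hf1])
    have := (hasDerivAt_of_mem_unitDisk hd1 hz).mul (hg z hz).neg.cexp
    refine this.congr_deriv ?_
    field_simp [hf' z hz]
    ring
  obtain ⟨ω, hω, hmaps, hω0, hgω⟩ := subordinate_snailQ hα hβ hγ hg hg0 hφ (fun z hz => by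
    have := hsub z hz
    simp only [snailT, add_right_inj] at this
    rw [← this, mul_div_assoc])
  refine ⟨ω, hω, hmaps, hω0, fun z hz => ?_⟩
  rw [← hgω z hz]
  have := hexp z hz
  rw [Complex.exp_neg] at this
  field_simp at this
  exact this

theorem norm_schwarz_le {ω : ℂ → ℂ} (hω : DifferentiableOn ℂ ω unitDisk)
    (hmaps : MapsTo ω unitDisk unitDisk) (h0 : ω 0 = 0) {z : ℂ} (hz : ‖z‖ < 1) : ‖ω z‖ ≤ ‖z‖ :=
  Complex.norm_le_norm_of_mapsTo_ball hω (hmaps.mono_right Metric.ball_subset_closedBall) h0 hz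

/-- Functions in the class are starlike: `Re (f / (z f')) > 0`. -/
theorem re_div_pos_of_mem_CVsnail (hα : -1 < α) (hαβ : α ≤ β) (hβ : β < 1) (hγ1 : γ < 1)
    (hγT : snailT0 α β ≤ γ) {f : ℂ → ℂ} (hf : f ∈ CVsnail α β γ) {z : ℂ} (hz0 : z ≠ 0)
    (hz : ‖z‖ < 1) : 0 < (f z / (z * deriv f z)).re := by
  obtain ⟨hfd, hf0, hf1, hf', φ, -, hφ, -, hsub⟩ := hf
  have hd1 : DifferentiableOn ℂ (deriv f) unitDisk := hfd.deriv isOpen_unitDisk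
  have hds : DifferentiableOn ℂ (dslope f 0) unitDisk :=
    (Complex.differentiableOn_dslope (isOpen_unitDisk.mem_nhds zero_mem_unitDisk)).2 hfd
  have hh : DifferentiableOn ℂ (fun w => dslope f 0 w / deriv f w) unitDisk := hds.div hd1 hf'
  have hfac : ∀ w, w * dslope f 0 w = f w := fun w => by
    have := sub_smul_dslope f 0 w
    simpa [hf0] using this
  have hid : ∀ w ∈ unitDisk, w * (dslope f 0 w / deriv f w) * deriv f w = f w := fun w hw => by
    rw [mul_assoc, div_mul_cancel₀ _ (hf' w hw), hfac]
  -- Differentiating `z h f' = f`, with `h` extended over `0` by `dslope`, gives `h (1 + z f''/f') +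
  -- z h' = 1`.
  have key := re_pos_of_mul_add_deriv_eq_one
    (P := fun w => 1 + w * deriv (deriv f) w / deriv f w)
    (fun w hw => hasDerivAt_of_mem_unitDisk hh hw) (by simp [hf1])
    (fun w hw => by
      have hw' : 1 + w * deriv (deriv f) w / deriv f w = snailT α β γ (φ w) := hsub w hw
      rw [hw']
      exact snailT_re_pos hα hαβ hβ hγ1 hγT (mem_unitDisk.1 (hφ hw)))
    (fun w hw => by
      have e1 := ((hasDerivAt_id w).mul (hasDerivAt_of_mem_unitDisk hh hw)).mul
        (hasDerivAt_of_mem_unitDisk hd1 hw)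
      have e2 := e1.congr_of_eventuallyEq (f₁ := f) (by
        filter_upwards [isOpen_unitDisk.mem_nhds hw] with v hv
        exact (hid v hv).symm)
      have e3 := e2.unique (hasDerivAt_of_mem_unitDisk hfd hw)
      simp only [Pi.mul_apply, id, one_mul] at e3
      apply mul_right_cancel₀ (hf' w hw)
      have e4 : w * deriv (deriv f) w / deriv f w * deriv f w = w * deriv (deriv f) w :=
        div_mul_cancel₀ _ (hf' w hw)
      linear_combination e3 + (dslope f 0 w / deriv f w) * e4)
    z (mem_unitDisk.2 hz)
  have : f z / (z * deriv f z) = dslope f 0 z / deriv f z := by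
    rw [← hfac z, mul_div_mul_left _ _ hz0]
  rwa [this]

/-! ### Growth and distortion -/

theorem hasDerivAt_neg_snailK_neg_re (hα : |α| < 1) (hβ : |β| < 1) {x : ℝ} (hx : |x| ≤ 1) :
    HasDerivAt (fun x : ℝ => -(snailK α β γ (-(x : ℂ))).re)
      (Real.exp (snailQ α β γ (-(x : ℂ))).re) x := by
  have h := hasDerivAt_snailK_re (γ := γ) hα hβ (x := -x) (by simpa using hx)
  have h2 := (h.comp x (hasDerivAt_neg x)).neg
  simp only [Complex.ofReal_neg] at h2
  refine (h2.congr_deriv (by ring)).congr_of_eventuallyEq (Eventually.of_forall fun y => ?_)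
  simp

theorem monotoneOn_snailK_re (hα : |α| < 1) (hβ : |β| < 1) :
    MonotoneOn (fun x : ℝ => (snailK α β γ x).re) (Icc (-1) 1) := by
  refine monotoneOn_of_deriv_nonneg (convex_Icc _ _)
    (fun x hx => (hasDerivAt_snailK_re hα hβ (abs_le.2 hx)).continuousAt.continuousWithinAt)
    (fun x hx => ?_) (fun x hx => ?_) <;>
    have hx : |x| ≤ 1 := abs_le.2 (mem_Icc.1 (interior_subset hx))
  · exact (hasDerivAt_snailK_re hα hβ hx).differentiableAt.differentiableWithinAt
  · rw [(hasDerivAt_snailK_re hα hβ hx).deriv]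
    exact (Real.exp_pos _).le

theorem norm_exp_snailQ_mem (hα : |α| < 1) (hβ : |β| < 1) (hγ : γ < 1) {w : ℂ} {r : ℝ}
    (hw : ‖w‖ ≤ r) (hr : r ≤ 1) :
    Real.exp (snailQ α β γ (-(r : ℂ))).re ≤ ‖Complex.exp (snailQ α β γ w)‖ ∧
      ‖Complex.exp (snailQ α β γ w)‖ ≤ Real.exp (snailQ α β γ (r : ℂ)).re := by
  rw [Complex.norm_exp, Real.exp_le_exp, Real.exp_le_exp]
  exact snailQ_re_mem hα hβ hγ hw hr

theorem deriv_snailK_re (hα : |α| < 1) (hβ : |β| < 1) {x : ℝ} (hx : |x| ≤ 1) :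
    (deriv (snailK α β γ) x).re = Real.exp (snailQ α β γ x).re := by
  rw [deriv_snailK hα hβ (by simpa using hx), exp_snailQ_ofReal, Complex.ofReal_re]

/-- Integration of the upper distortion bound along the radius, as a mean value inequality. -/
theorem norm_le_snailK (hα : |α| < 1) (hβ : |β| < 1) (hγ : γ < 1) {f : ℂ → ℂ}
    (hf : f ∈ CVsnail α β γ) {z : ℂ} (hz : ‖z‖ < 1) : ‖f z‖ ≤ (snailK α β γ (‖z‖ : ℂ)).re := by
  obtain ⟨ω, hω, hmaps, hω0, hfω⟩ := exists_deriv_eq_exp_snailQ hα hβ hγ hf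
  have hmem : ∀ t ∈ Icc (0 : ℝ) 1, ‖(t : ℂ) * z‖ = t * ‖z‖ ∧ t * ‖z‖ < 1 := fun t ht => by
    rw [norm_mul, Complex.norm_real, Real.norm_of_nonneg ht.1]
    exact ⟨rfl, (mul_le_of_le_one_left (norm_nonneg z) ht.2).trans_lt hz⟩
  have hder : ∀ t ∈ Icc (0 : ℝ) 1,
      HasDerivAt (fun t : ℝ => f (t * z)) (deriv f (t * z) * z) t := by
    intro t ht
    have h1 : HasDerivAt (fun τ : ℂ => τ * z) z (t : ℂ) := by
      simpa using (hasDerivAt_id (t : ℂ)).mul_const z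
    have h2 := hasDerivAt_of_mem_unitDisk hf.1
      (mem_unitDisk.2 ((hmem t ht).1.trans_lt (hmem t ht).2))
    exact (HasDerivAt.comp (t : ℂ) h2 h1).comp_ofReal
  have hB : ∀ t ∈ Icc (0 : ℝ) 1, HasDerivAt (fun t : ℝ => (snailK α β γ ((t * ‖z‖ : ℝ) : ℂ)).re)
      (Real.exp (snailQ α β γ ((t * ‖z‖ : ℝ) : ℂ)).re * ‖z‖) t := by
    intro t ht
    have h1 : HasDerivAt (fun t : ℝ => t * ‖z‖) ‖z‖ t := by
      simpa using (hasDerivAt_id t).mul_const ‖z‖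
    have h2 := hasDerivAt_snailK_re (γ := γ) hα hβ (x := t * ‖z‖) (by
      rw [abs_of_nonneg (mul_nonneg ht.1 (norm_nonneg z))]; exact (hmem t ht).2.le)
    exact h2.comp t h1
  have := image_norm_le_of_norm_deriv_right_le_deriv_boundary'
    (f := fun t : ℝ => f (t * z)) (a := 0) (b := 1)
    (fun t ht => (hder t ht).continuousAt.continuousWithinAt)
    (fun t ht => (hder t (Ico_subset_Icc_self ht)).hasDerivWithinAt)
    (by simp [hf.2.1, snailK_zero])
    (fun t ht => (hB t ht).continuousAt.continuousWithinAt)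
    (fun t ht => (hB t (Ico_subset_Icc_self ht)).hasDerivWithinAt)
    (fun t ht => by
      obtain ⟨h1, h2⟩ := hmem t (Ico_subset_Icc_self ht)
      rw [norm_mul, hfω _ (mem_unitDisk.2 (h1.trans_lt h2))]
      gcongr
      refine (norm_exp_snailQ_mem hα hβ hγ ?_ h2.le).2
      exact (norm_schwarz_le hω hmaps hω0 (h1.trans_lt h2)).trans h1.le)
    (right_mem_Icc.2 zero_le_one)
  simpa using this

/-- If the derivative of `k` is smaller than `|f'|` and `f` is starlike, then `k ≤ |f|`. -/
theorem le_norm_of_deriv_lt {f : ℂ → ℂ} {k k' : ℝ → ℝ}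
    (hf : DifferentiableOn ℂ f unitDisk) (hf0 : f 0 = 0)
    (hk : ∀ ρ, 0 < ρ → ρ < 1 → HasDerivAt k (k' ρ) ρ) (hkc : ContinuousAt k 0) (hk0 : k 0 = 0)
    (hk' : ∀ ρ, 0 < ρ → ρ < 1 → 0 ≤ k' ρ)
    (hkf : ∀ z, z ≠ 0 → ‖z‖ < 1 → k' ‖z‖ < ‖deriv f z‖)
    (hh : ∀ z, z ≠ 0 → ‖z‖ < 1 → 0 < (f z / (z * deriv f z)).re) {z : ℂ} (hz : ‖z‖ < 1) :
    k ‖z‖ ≤ ‖f z‖ := by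
  rcases eq_or_ne z 0 with rfl | hz0
  · simp [hf0, hk0]
  -- The inner radius `a` tends to `0`, where only `|f| ≥ 0` is needed.
  have h1 : ∀ᶠ a in 𝓝[>] (0 : ℝ), -k a ≤ ‖f z‖ - k ‖z‖ := by
    filter_upwards [Ioo_mem_nhdsGT (norm_pos_iff.2 hz0)] with a ha
    obtain ⟨w, hw, hle⟩ := exists_norm_sub_le_inner_circle hf hk hk' hkf hh ha.1 ha.2.le hz
    rw [hw] at hle
    linarith [norm_nonneg (f w)]
  have h2 : Tendsto (fun a => -k a) (𝓝[>] 0) (𝓝 (-k 0)) :=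
    (hkc.tendsto.mono_left nhdsWithin_le_nhds).neg
  have := le_of_tendsto h2 h1
  rw [hk0] at this
  linarith

/-- Distortion gives only a weak inequality of derivatives, so the comparison function is scaled by
`c < 1` to make it strict, and then `c → 1`. -/
theorem neg_snailK_neg_le_norm (hα : -1 < α) (hαβ : α ≤ β) (hβ : β < 1) (hγ1 : γ < 1)
    (hγT : snailT0 α β ≤ γ) {f : ℂ → ℂ} (hf : f ∈ CVsnail α β γ) {z : ℂ} (hz : ‖z‖ < 1) :
    -(snailK α β γ (-(‖z‖ : ℂ))).re ≤ ‖f z‖ := by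
  have hα' : |α| < 1 := abs_lt.2 ⟨hα, hαβ.trans_lt hβ⟩
  have hβ' : |β| < 1 := abs_lt.2 ⟨hα.trans_le hαβ, hβ⟩
  obtain ⟨ω, hω, hmaps, hω0, hfω⟩ := exists_deriv_eq_exp_snailQ hα' hβ' hγ1 hf
  have hc : ∀ᶠ c in 𝓝[<] (1 : ℝ), c * -(snailK α β γ (-(‖z‖ : ℂ))).re ≤ ‖f z‖ := by
    filter_upwards [Ioo_mem_nhdsLT (zero_lt_one' ℝ)] with c hc
    refine le_norm_of_deriv_lt (k := fun x : ℝ => c * -(snailK α β γ (-(x : ℂ))).re)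
      (k' := fun x : ℝ => c * Real.exp (snailQ α β γ (-(x : ℂ))).re) hf.1 hf.2.1
      (fun ρ h0 h1 => (hasDerivAt_neg_snailK_neg_re hα' hβ' (abs_le.2
        ⟨by linarith, h1.le⟩)).const_mul c)
      ((hasDerivAt_neg_snailK_neg_re hα' hβ' (by simp)).const_mul c).continuousAt
      (by simp [snailK_zero]) (fun ρ _ _ => mul_nonneg hc.1.le (Real.exp_pos _).le)
      (fun w hw0 hw => ?_)
      (fun w hw0 hw => re_div_pos_of_mem_CVsnail hα hαβ hβ hγ1 hγT hf hw0 hw) hz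
    rw [hfω w (mem_unitDisk.2 hw)]
    refine lt_of_lt_of_le ?_
      (norm_exp_snailQ_mem hα' hβ' hγ1 (norm_schwarz_le hω hmaps hω0 hw) hw.le).1
    exact mul_lt_of_lt_one_left (Real.exp_pos _) hc.2
  have h1 : Tendsto (fun c : ℝ => c * -(snailK α β γ (-(‖z‖ : ℂ))).re) (𝓝[<] 1)
      (𝓝 (1 * -(snailK α β γ (-(‖z‖ : ℂ))).re)) :=
    ((continuous_id.mul continuous_const).tendsto 1).mono_left nhdsWithin_le_nhds
  rw [one_mul] at h1
  exact le_of_tendsto h1 hc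

/-! ### Rotation theorem -/

theorem arg_exp_eq_im {u : ℂ} (h1 : -Real.pi < u.im) (h2 : u.im ≤ Real.pi) :
    Complex.arg (Complex.exp u) = u.im := by
  rw [← Complex.log_im, Complex.log_exp h1 h2]

/-- If `Im Q` reaches `π` on the circle, continuity from the real point gives the value exactly `π`,
the largest possible argument. Otherwise no branch jump occurs, `Arg K' = Im Q`, and the maximum
principle with conjugation symmetry applies. The bound covers the whole closed disk because `ω(z)`
may lie inside the circle. -/
theorem exists_isGreatest_argValues (hα : |α| < 1) (hβ : |β| < 1) {r : ℝ} (hr0 : 0 ≤ r)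
    (hr : r < 1) :
    ∃ M : ℝ, IsGreatest (argValues α β γ r) M ∧
      ∀ w : ℂ, ‖w‖ ≤ r → |Complex.arg (Complex.exp (snailQ α β γ w))| ≤ M := by
  have hd : ∀ w : ℂ, ‖w‖ ≤ r → deriv (snailK α β γ) w = Complex.exp (snailQ α β γ w) :=
    fun w hw => deriv_snailK hα hβ (hw.trans hr.le)
  have hcont : ∀ w : ℂ, ‖w‖ ≤ r → ContinuousAt (fun w => (snailQ α β γ w).im) w := fun w hw =>
    Complex.continuous_im.continuousAt.comp
      (hasDerivAt_snailQ hα hβ (hw.trans hr.le)).continuousAt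
  by_cases hpi : ∃ w : ℂ, ‖w‖ = r ∧ Real.pi ≤ (snailQ α β γ w).im
  · obtain ⟨w, hw, hwpi⟩ := hpi
    have hn : ∀ θ : ℝ, ‖(r : ℂ) * Complex.exp (θ * Complex.I)‖ = r := fun θ => by
      rw [norm_mul, Complex.norm_exp_ofReal_mul_I, mul_one, Complex.norm_real,
        Real.norm_of_nonneg hr0]
    have hc : Continuous (fun θ : ℝ => (snailQ α β γ (r * Complex.exp (θ * Complex.I))).im) := by
      refine continuous_iff_continuousAt.2 fun θ => ?_
      exact ContinuousAt.comp (g := fun w => (snailQ α β γ w).im) (hcont _ (hn θ).le)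
        (by fun_prop)
    have hw' : (r : ℂ) * Complex.exp (Complex.arg w * Complex.I) = w := by
      rw [← hw]; exact Complex.norm_mul_exp_arg_mul_I w
    obtain ⟨θ, hθ⟩ := mem_range_of_exists_le_of_exists_ge hc
      ⟨0, by simpa [snailQ_ofReal_im] using Real.pi_pos.le⟩ ⟨Complex.arg w, by rwa [hw']⟩
    replace hθ : (snailQ α β γ (r * Complex.exp (θ * Complex.I))).im = Real.pi := hθ
    refine ⟨Real.pi, ⟨⟨_, hn θ, ?_⟩, ?_⟩, fun w _ => Complex.abs_arg_le_pi _⟩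
    · simp only [hd _ (hn θ).le]
      rw [arg_exp_eq_im (by rw [hθ]; linarith [Real.pi_pos]) hθ.le, hθ]
    · rintro _ ⟨v, -, rfl⟩
      exact Complex.arg_le_pi _
  · push Not at hpi
    have hne : (Metric.sphere (0 : ℂ) r).Nonempty := ⟨r, by simpa using hr0⟩
    obtain ⟨w₀, hw₀, hmax⟩ := (isCompact_sphere (0 : ℂ) r).exists_isMaxOn hne
      (f := fun w => (snailQ α β γ w).im)
      (fun w hw => (hcont w (mem_sphere_zero_iff_norm.1 hw).le).continuousWithinAt)
    rw [mem_sphere_zero_iff_norm] at hw₀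
    have hle : ∀ w : ℂ, ‖w‖ = r → (snailQ α β γ w).im ≤ (snailQ α β γ w₀).im := fun w hw =>
      hmax (mem_sphere_zero_iff_norm.2 hw)
    have hge : ∀ w : ℂ, ‖w‖ = r → -(snailQ α β γ w).im ≤ (snailQ α β γ w₀).im := fun w hw => by
      have := hle ((starRingEnd ℂ) w) (by simpa using hw)
      simpa [snailQ_conj] using this
    have hdiff : ∀ w : ℂ, ‖w‖ ≤ r → DifferentiableAt ℂ (snailQ α β γ) w := fun w hw =>
      (hasDerivAt_snailQ hα hβ (hw.trans hr.le)).differentiableAt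
    have habs : ∀ w : ℂ, ‖w‖ ≤ r → |(snailQ α β γ w).im| ≤ (snailQ α β γ w₀).im := by
      intro w hw
      have h1 := re_le_of_re_le_sphere (F := fun w => -Complex.I * snailQ α β γ w)
        (fun w hw => (hdiff w hw).const_mul _) (fun w hw => by simpa using hle w hw) hw
      have h2 := re_le_of_re_le_sphere (F := fun w => Complex.I * snailQ α β γ w)
        (fun w hw => (hdiff w hw).const_mul _) (fun w hw => by simpa using hge w hw) hw
      simp at h1 h2
      exact abs_le.2 ⟨by linarith, h1⟩
    have harg : ∀ w : ℂ, ‖w‖ ≤ r →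
        Complex.arg (Complex.exp (snailQ α β γ w)) = (snailQ α β γ w).im := by
      intro w hw
      have := abs_le.1 (habs w hw)
      have hlt := hpi w₀ hw₀
      exact arg_exp_eq_im (by linarith) (by linarith)
    refine ⟨(snailQ α β γ w₀).im, ⟨⟨w₀, hw₀, ?_⟩, ?_⟩, fun w hw => ?_⟩
    · simp only [hd w₀ hw₀.le, harg w₀ hw₀.le]
    · rintro _ ⟨v, hv, rfl⟩
      have hv : ‖v‖ = r := hv
      simp only [hd v hv.le, harg v hv.le]
      exact hle v hv
    · rw [harg w hw]
      exact habs w hw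

/-! ### Rotations of `K` -/

theorem hasDerivAt_rotK (hα : |α| < 1) (hβ : |β| < 1) {μ z : ℂ} (hμ : ‖μ‖ = 1) (hz : ‖z‖ ≤ 1) :
    HasDerivAt (rotK α β γ μ) (Complex.exp (snailQ α β γ (μ * z))) z := by
  have h1 : HasDerivAt (fun z => μ * z) μ z := by simpa using (hasDerivAt_id z).const_mul μ
  have h2 := hasDerivAt_snailK (γ := γ) hα hβ (z := μ * z) (by rw [norm_mul, hμ, one_mul]; exact hz)
  have h3 := (HasDerivAt.comp z h2 h1).const_mul ((starRingEnd ℂ) μ)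
  refine h3.congr_deriv ?_
  have : μ * (starRingEnd ℂ) μ = 1 := by
    rw [Complex.mul_conj, Complex.normSq_eq_norm_sq, hμ]; simp
  linear_combination Complex.exp (snailQ α β γ (μ * z)) * this

theorem rotK_mem_CVsnail (hα : |α| < 1) (hβ : |β| < 1) {μ : ℂ} (hμ : ‖μ‖ = 1) :
    rotK α β γ μ ∈ CVsnail α β γ := by
  have hn : ∀ z : ℂ, ‖μ * z‖ = ‖z‖ := fun z => by rw [norm_mul, hμ, one_mul]
  have hder : ∀ z ∈ unitDisk, deriv (rotK α β γ μ) z = Complex.exp (snailQ α β γ (μ * z)) :=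
    fun z hz => (hasDerivAt_rotK hα hβ hμ (mem_unitDisk.1 hz).le).deriv
  refine ⟨fun z hz => (hasDerivAt_rotK hα hβ hμ
    (mem_unitDisk.1 hz).le).differentiableAt.differentiableWithinAt, ?_, ?_, fun z hz => ?_,
    fun z => μ * z, by fun_prop, fun z hz => ?_, by simp, fun z hz => ?_⟩
  · simp [rotK, snailK_zero]
  · rw [hder 0 zero_mem_unitDisk, mul_zero, snailQ_zero, Complex.exp_zero]
  · rw [hder z hz]
    exact Complex.exp_ne_zero _
  · rw [mem_unitDisk, hn]
    exact mem_unitDisk.1 hz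
  · have h1 : HasDerivAt (fun z => μ * z) μ z := by simpa using (hasDerivAt_id z).const_mul μ
    have h2 := hasDerivAt_snailQ (γ := γ) hα hβ (z := μ * z)
      (by rw [hn]; exact (mem_unitDisk.1 hz).le)
    have h3 := (HasDerivAt.comp z h2 h1).cexp
    have h4 := h3.congr_of_eventuallyEq (f₁ := deriv (rotK α β γ μ)) (by
      filter_upwards [isOpen_unitDisk.mem_nhds hz] with w hw
      exact hder w hw)
    simp only [h4.deriv, hder z hz, snailT, snailL_eq, Function.comp]
    field_simp

theorem exists_rotation {z w : ℂ} (hz : z ≠ 0) (h : ‖w‖ = ‖z‖) : ∃ μ : ℂ, ‖μ‖ = 1 ∧ μ * z = w :=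
  ⟨w / z, by rw [norm_div, h, div_self (norm_ne_zero_iff.2 hz)], div_mul_cancel₀ w hz⟩

theorem norm_rotK {μ : ℂ} (hμ : ‖μ‖ = 1) (z : ℂ) :
    ‖rotK α β γ μ z‖ = ‖snailK α β γ (μ * z)‖ := by
  rw [rotK, norm_mul, RCLike.norm_conj, hμ, one_mul]

theorem norm_snailK_ofReal (x : ℝ) : ‖snailK α β γ x‖ = |(snailK α β γ x).re| :=
  (Complex.abs_re_eq_norm.2 (snailK_ofReal_im x)).symm

/-! ### Covering -/

/-- Either `f` is a rotation of `K`, or the distortion theorem holds with strict inequality. -/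
theorem eq_rotK_or_lt_norm_deriv (hα : |α| < 1) (hβ : |β| < 1) (hγ : γ < 1) {f : ℂ → ℂ}
    (hf : f ∈ CVsnail α β γ) :
    (∃ μ : ℂ, ‖μ‖ = 1 ∧ ∀ z ∈ unitDisk, f z = rotK α β γ μ z) ∨
      ∀ z, z ≠ 0 → ‖z‖ < 1 → Real.exp (snailQ α β γ (-(‖z‖ : ℂ))).re < ‖deriv f z‖ := by
  obtain ⟨ω, hω, hmaps, hω0, hfω⟩ := exists_deriv_eq_exp_snailQ hα hβ hγ hf
  by_cases hrot : ∃ z, z ≠ 0 ∧ ‖z‖ < 1 ∧ ‖ω z‖ = ‖z‖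
  · left
    obtain ⟨z₀, hz₀, hz₁, heq⟩ := hrot
    -- Equality in the Schwarz lemma at one point makes `ω` a rotation.
    obtain ⟨μ, hμ, hlin⟩ := Complex.affine_of_mapsTo_ball_of_exists_norm_dslope_eq_div' (R₂ := 1)
      hω (by rw [hω0]; exact hmaps.mono_right Metric.ball_subset_closedBall)
      ⟨z₀, mem_unitDisk.2 hz₁, by
        rw [dslope_of_ne _ hz₀, slope_def_field, hω0, sub_zero, sub_zero, norm_div, heq,
          div_self (norm_ne_zero_iff.2 hz₀), div_one]⟩
    rw [div_one] at hμ
    refine ⟨μ, hμ, eqOn_unitDisk_of_hasDerivAt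
      (fun z hz => hasDerivAt_of_mem_unitDisk hf.1 hz) (fun z hz => ?_) ?_⟩
    · rw [hfω z hz, hlin hz]
      simpa [hω0, mul_comm] using
        hasDerivAt_rotK (γ := γ) hα hβ hμ (mem_unitDisk.1 hz).le
    · simp [hf.2.1, rotK, snailK_zero]
  · right
    push Not at hrot
    intro z hz0 hz
    have hlt : ‖ω z‖ < ‖z‖ :=
      lt_of_le_of_ne (norm_schwarz_le hω hmaps hω0 hz) (hrot z hz0 hz)
    rw [hfω z (mem_unitDisk.2 hz)]
    refine lt_of_lt_of_le ?_ (norm_exp_snailQ_mem hα hβ hγ le_rfl (hlt.trans hz).le).1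
    rw [Real.exp_lt_exp]
    have := strictMonoOn_snailQ_re (γ := γ) hα hβ hγ (a := -‖z‖) (b := -‖ω z‖)
      ⟨by linarith, by linarith [norm_nonneg z]⟩
      ⟨by linarith, by linarith [norm_nonneg (ω z)]⟩ (by linarith)
    simpa using this

/-- Strict distortion produces a gap `δ > 0` with `|f| ≥ k(|z|) + δ` near the boundary. Since `k(r)
→ k(1)`, some `r < 1` has `k(r) + δ > k(1)`, so even the closed disk of radius `k(1)` is covered. -/
theorem closedBall_subset_image (hα : -1 < α) (hαβ : α ≤ β) (hβ : β < 1) (hγ1 : γ < 1)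
    (hγT : snailT0 α β ≤ γ) {f : ℂ → ℂ} (hf : f ∈ CVsnail α β γ)
    (hlt : ∀ z, z ≠ 0 → ‖z‖ < 1 → Real.exp (snailQ α β γ (-(‖z‖ : ℂ))).re < ‖deriv f z‖) :
    {w : ℂ | ‖w‖ ≤ -(snailK α β γ (-((1 : ℝ) : ℂ))).re} ⊆ f '' unitDisk := by
  have hα' : |α| < 1 := abs_lt.2 ⟨hα, hαβ.trans_lt hβ⟩
  have hβ' : |β| < 1 := abs_lt.2 ⟨hα.trans_le hαβ, hβ⟩
  set k : ℝ → ℝ := fun x => -(snailK α β γ (-(x : ℂ))).re with hk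
  have hkd : ∀ ρ : ℝ, 0 < ρ → ρ < 1 →
      HasDerivAt k (Real.exp (snailQ α β γ (-(ρ : ℂ))).re) ρ := fun ρ h0 h1 =>
    hasDerivAt_neg_snailK_neg_re hα' hβ' (abs_le.2 ⟨by linarith, h1.le⟩)
  have hstar : ∀ z, z ≠ 0 → ‖z‖ < 1 → 0 < (f z / (z * deriv f z)).re := fun z h0 h1 =>
    re_div_pos_of_mem_CVsnail hα hαβ hβ hγ1 hγT hf h0 h1
  have hnn : ∀ z, ‖z‖ < 1 → k ‖z‖ ≤ ‖f z‖ := fun z hz =>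
    neg_snailK_neg_le_norm hα hαβ hβ hγ1 hγT hf hz
  have hcontf : ContinuousOn (fun z => ‖f z‖) (Metric.sphere (0 : ℂ) (1 / 2)) :=
    (hf.1.continuousOn.mono (fun z hz => mem_unitDisk.2 (by
      rw [mem_sphere_zero_iff_norm.1 hz]; norm_num))).norm
  obtain ⟨w₀, hw₀, hmin⟩ := (isCompact_sphere (0 : ℂ) (1 / 2)).exists_isMinOn
    ⟨(1 / 2 : ℝ), by simp⟩ hcontf
  rw [mem_sphere_zero_iff_norm] at hw₀
  have hw1 : ‖w₀‖ < 1 := by rw [hw₀]; norm_num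
  have hw0 : w₀ ≠ 0 := norm_pos_iff.1 (by rw [hw₀]; norm_num)
  -- A zero gap at `w₀` could be lowered by the descent step, contradicting `k ≤ |f|`.
  have hδ : 0 < ‖f w₀‖ - k ‖w₀‖ := by
    obtain ⟨v, hv1, hv2⟩ := (frequently_norm_sub_lt hw0
      (hasDerivAt_of_mem_unitDisk hf.1 (mem_unitDisk.2 hw1))
      (hkd _ (norm_pos_iff.2 hw0) hw1) (Real.exp_pos _).le (hlt w₀ hw0 hw1)
      (hstar w₀ hw0 hw1)).exists
    linarith [hnn v (hv1.trans hw1)]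
  set δ := ‖f w₀‖ - k ‖w₀‖ with hδdef
  have hlow : ∀ z, 1 / 2 ≤ ‖z‖ → ‖z‖ < 1 → k ‖z‖ + δ ≤ ‖f z‖ := by
    intro z hz1 hz2
    obtain ⟨w, hw, hle⟩ := exists_norm_sub_le_inner_circle hf.1 hkd
      (fun ρ _ _ => (Real.exp_pos _).le) hlt hstar (by norm_num : (0 : ℝ) < 1 / 2) hz1 hz2
    have : ‖f w₀‖ ≤ ‖f w‖ := hmin (mem_sphere_zero_iff_norm.2 hw)
    rw [hw] at hle
    rw [hδdef, hw₀]
    linarith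
  have hkc : ContinuousAt k 1 :=
    (hasDerivAt_neg_snailK_neg_re hα' hβ' (by simp)).continuousAt
  have hev : ∀ᶠ r in 𝓝[<] (1 : ℝ), k 1 - δ < k r :=
    (hkc.tendsto.mono_left nhdsWithin_le_nhds).eventually_const_lt (by linarith)
  obtain ⟨r, hr, hr1, hr2⟩ := (hev.and (Ioo_mem_nhdsLT (by norm_num : (1 / 2 : ℝ) < 1))).exists
  refine Subset.trans (fun w hw => ?_) (ball_subset_image (r := r) (k := k r + δ) (by linarith) hr2
    hf.1 hf.2.1 hf.2.2.2.1 (fun z hz => ?_))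
  · have hw : ‖w‖ ≤ k 1 := hw
    rw [mem_ball_zero_iff]
    linarith
  · have := hlow z (by rw [hz]; exact hr1.le) (by rw [hz]; exact hr2)
    rwa [hz] at this

end Analytic

end Snail

end

/-! ### Assembly of the four claims -/

theorem mainTheorem4 (α β γ : ℝ) (hα : -1 < α) (hαβ : α ≤ β) (hβ : β < 1)
    (hγ0 : 0 ≤ γ) (hγ1 : γ < 1) (hγT : Snail.snailT0 α β ≤ γ) :
    -- `K` and `K'` are real on the interval `(-1, 1)`
    (∀ x : ℝ, |x| < 1 →
      (Snail.snailK α β γ (x : ℂ)).im = 0 ∧ (deriv (Snail.snailK α β γ) (x : ℂ)).im = 0) ∧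
    -- growth, distortion and rotation bounds, and the subordination of the derivative
    (∀ f ∈ Snail.CVsnail α β γ,
      (∀ z : ℂ, ∀ r : ℝ, ‖z‖ = r → r < 1 →
        (-(Snail.snailK α β γ (-(r : ℂ))).re ≤ ‖f z‖ ∧
          ‖f z‖ ≤ (Snail.snailK α β γ (r : ℂ)).re) ∧
        ((deriv (Snail.snailK α β γ) (-(r : ℂ))).re ≤ ‖deriv f z‖ ∧
          ‖deriv f z‖ ≤ (deriv (Snail.snailK α β γ) (r : ℂ)).re) ∧
        (∃ M : ℝ, IsGreatest (Snail.argValues α β γ r) M ∧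
          |Complex.arg (deriv f z)| ≤ M)) ∧
      Snail.Subordinate (deriv f) (deriv (Snail.snailK α β γ))) ∧
    -- sharpness: the rotations of `K` belong to the class, and at every point other than `0`
    -- each of the bounds is attained by one of them
    (∀ μ : ℂ, ‖μ‖ = 1 → Snail.rotK α β γ μ ∈ Snail.CVsnail α β γ) ∧
    (∀ z : ℂ, ∀ r : ℝ, z ≠ 0 → ‖z‖ = r → r < 1 →
      (∃ μ : ℂ, ‖μ‖ = 1 ∧
        ‖Snail.rotK α β γ μ z‖ = -(Snail.snailK α β γ (-(r : ℂ))).re) ∧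
      (∃ μ : ℂ, ‖μ‖ = 1 ∧
        ‖Snail.rotK α β γ μ z‖ = (Snail.snailK α β γ (r : ℂ)).re) ∧
      (∃ μ : ℂ, ‖μ‖ = 1 ∧
        ‖deriv (Snail.rotK α β γ μ) z‖ = (deriv (Snail.snailK α β γ) (-(r : ℂ))).re) ∧
      (∃ μ : ℂ, ‖μ‖ = 1 ∧
        ‖deriv (Snail.rotK α β γ μ) z‖ = (deriv (Snail.snailK α β γ) (r : ℂ)).re) ∧
      (∃ μ : ℂ, ‖μ‖ = 1 ∧
        IsGreatest (Snail.argValues α β γ r)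
          |Complex.arg (deriv (Snail.rotK α β γ μ) z)|)) ∧
    -- covering: `k = -K(-1)` is the limit of `-K(-r)` as `r → 1⁻`
    (∃ k : ℝ,
      Tendsto (fun r : ℝ => -(Snail.snailK α β γ (-(r : ℂ))).re) (𝓝[<] 1) (𝓝 k) ∧
      ∀ f ∈ Snail.CVsnail α β γ,
        (∃ μ : ℂ, ‖μ‖ = 1 ∧ ∀ z ∈ Snail.unitDisk, f z = Snail.rotK α β γ μ z) ∨
        {w : ℂ | ‖w‖ ≤ k} ⊆ f '' Snail.unitDisk) := by
  have hα' : |α| < 1 := abs_lt.2 ⟨hα, hαβ.trans_lt hβ⟩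
  have hβ' : |β| < 1 := abs_lt.2 ⟨hα.trans_le hαβ, hβ⟩
  have hderiv : ∀ r : ℝ, 0 ≤ r → r < 1 →
      (deriv (Snail.snailK α β γ) (-(r : ℂ))).re =
        Real.exp (Snail.snailQ α β γ (-(r : ℂ))).re ∧
      (deriv (Snail.snailK α β γ) (r : ℂ)).re = Real.exp (Snail.snailQ α β γ (r : ℂ)).re := by
    intro r hr0 hr
    have h := Snail.deriv_snailK_re (γ := γ) hα' hβ' (x := -r)
      (abs_le.2 ⟨by linarith, by linarith⟩)
    rw [Complex.ofReal_neg] at h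
    exact ⟨h, Snail.deriv_snailK_re hα' hβ' (abs_le.2 ⟨by linarith, hr.le⟩)⟩
  refine ⟨fun x hx => ⟨Snail.snailK_ofReal_im x, ?_⟩, fun f hf => ⟨fun z r hz hr => ?_, ?_⟩,
    fun μ hμ => Snail.rotK_mem_CVsnail hα' hβ' hμ, fun z r hz0 hz hr => ?_,
    -(Snail.snailK α β γ (-((1 : ℝ) : ℂ))).re, ?_, fun f hf => ?_⟩
  · rw [Snail.deriv_snailK hα' hβ' (by simpa using hx.le), Snail.exp_snailQ_ofReal,
      Complex.ofReal_im]
  · obtain ⟨ω, hω, hmaps, hω0, hfω⟩ := Snail.exists_deriv_eq_exp_snailQ hα' hβ' hγ1 hf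
    have hz1 : ‖z‖ < 1 := hz.trans_lt hr
    have hr0 : 0 ≤ r := hz ▸ norm_nonneg z
    have hωz : ‖ω z‖ ≤ r := (Snail.norm_schwarz_le hω hmaps hω0 hz1).trans hz.le
    obtain ⟨M, hM, hle⟩ := Snail.exists_isGreatest_argValues (γ := γ) hα' hβ' hr0 hr
    rw [(hderiv r hr0 hr).1, (hderiv r hr0 hr).2, hfω z (Snail.mem_unitDisk.2 hz1)]
    refine ⟨⟨?_, ?_⟩, Snail.norm_exp_snailQ_mem hα' hβ' hγ1 hωz hr.le, M, hM, hle _ hωz⟩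
    · rw [← hz]
      exact Snail.neg_snailK_neg_le_norm hα hαβ hβ hγ1 hγT hf hz1
    · rw [← hz]
      exact Snail.norm_le_snailK hα' hβ' hγ1 hf hz1
  · obtain ⟨ω, hω, hmaps, hω0, hfω⟩ := Snail.exists_deriv_eq_exp_snailQ hα' hβ' hγ1 hf
    refine ⟨ω, hω, hmaps, hω0, fun z hz => ?_⟩
    rw [hfω z hz, Snail.deriv_snailK hα' hβ' (Snail.mem_unitDisk.1 (hmaps hz)).le]
  · have hr0 : 0 ≤ r := hz ▸ norm_nonneg z
    have hrot : ∀ w : ℂ, ‖w‖ = r → ∃ μ : ℂ, ‖μ‖ = 1 ∧ μ * z = w ∧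
        deriv (Snail.rotK α β γ μ) z = deriv (Snail.snailK α β γ) w := by
      intro w hw
      obtain ⟨μ, hμ, hμz⟩ := Snail.exists_rotation hz0 (hw.trans hz.symm)
      refine ⟨μ, hμ, hμz, ?_⟩
      rw [(Snail.hasDerivAt_rotK hα' hβ' hμ (hz.trans_lt hr).le).deriv, hμz,
        Snail.deriv_snailK hα' hβ' (hw.trans_lt hr).le]
    have hnorm : ∀ w : ℂ, ‖w‖ = r →
        ‖deriv (Snail.snailK α β γ) w‖ = Real.exp (Snail.snailQ α β γ w).re := fun w hw => by
      rw [Snail.deriv_snailK hα' hβ' (hw.trans_lt hr).le, Complex.norm_exp]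
    have hmono := Snail.monotoneOn_snailK_re (γ := γ) hα' hβ'
    have hpos : ‖(r : ℂ)‖ = r := by rw [Complex.norm_real, Real.norm_of_nonneg hr0]
    have hneg : ‖-(r : ℂ)‖ = r := by rw [norm_neg, hpos]
    obtain ⟨μ₁, hμ₁, h₁, hd₁⟩ := hrot _ hpos
    obtain ⟨μ₂, hμ₂, h₂, hd₂⟩ := hrot _ hneg
    refine ⟨⟨μ₂, hμ₂, ?_⟩, ⟨μ₁, hμ₁, ?_⟩, ⟨μ₂, hμ₂, ?_⟩, ⟨μ₁, hμ₁, ?_⟩, ?_⟩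
    · have h := hmono (a := -r) (b := 0) ⟨by linarith, by linarith⟩ ⟨by norm_num, by norm_num⟩
        (by linarith)
      simp only [Complex.ofReal_zero, Snail.snailK_zero, Complex.zero_re] at h
      rw [Snail.norm_rotK hμ₂, h₂, ← Complex.ofReal_neg, Snail.norm_snailK_ofReal,
        abs_of_nonpos h]
    · have h := hmono (a := 0) (b := r) ⟨by norm_num, by norm_num⟩ ⟨by linarith, hr.le⟩ hr0
      simp only [Complex.ofReal_zero, Snail.snailK_zero, Complex.zero_re] at h
      rw [Snail.norm_rotK hμ₁, h₁, Snail.norm_snailK_ofReal, abs_of_nonneg h]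
    · rw [hd₂, hnorm _ hneg, (hderiv r hr0 hr).1]
    · rw [hd₁, hnorm _ hpos, (hderiv r hr0 hr).2]
    · obtain ⟨M, hM, hle⟩ := Snail.exists_isGreatest_argValues (γ := γ) hα' hβ' hr0 hr
      obtain ⟨w, hw, hwM⟩ := hM.1
      have hw : ‖w‖ = r := hw
      have hwM : Complex.arg (deriv (Snail.snailK α β γ) w) = M := hwM
      obtain ⟨μ, hμ, -, hd⟩ := hrot w hw
      refine ⟨μ, hμ, ?_⟩
      -- The maximum is nonnegative because it bounds an absolute value, here at the origin.
      rw [hd, hwM, abs_of_nonneg ((abs_nonneg _).trans (hle 0 (by simpa using hr0)))]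
      exact hM
  · exact (Snail.hasDerivAt_neg_snailK_neg_re hα' hβ' (by simp)).continuousAt.tendsto.mono_left
      nhdsWithin_le_nhds
  · exact (Snail.eq_rotK_or_lt_norm_deriv hα' hβ' hγ1 hf).imp_right fun hlt =>
      Snail.closedBall_subset_image hα hαβ hβ hγ1 hγT hf hlt
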